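/- Let $n\ge 1$ candidates have non-negative valuations $\rho_i$ (receiver) and $\xi_i$ (sender) such that the pairs $(\rho_i,\xi_i)$, $i\in[n]$, are pairwise distinct, and let them arrive in uniformly random order, one per round. In round $t$ the sender observes the pair of the arriving candidate $\theta_t$ and sends a signal $\sigma_t\in\{\mathrm{HIRE},\mathrm{NOT}\}$. The receiver, who knows all pairs, the mechanism, and that the order is uniform, but sees only the signals so far (no disclosure), then irrevocably hires or rejects the candidate; hiring ends the process, and if nobody is hired both utilities are $0$. A (randomized) mechanism determines the distribution of $\sigma_t$ from the pairs observed up to round $t$ and the signals $\sigma_1,\dots,\sigma_{t-1}$. It is *persuasive* if in every round $t$ reached under obedience (that is, with $\sigma_1=\dots=\sigma_{t-1}=\mathrm{NOT}$), after each signal $\sigma_t$ of positive probability, obeying from then on (hire upon HIRE, reject upon NOT) maximizes the receiver's conditional expected utility, given the signals seen, among all continuation strategies. Let $\mathrm{OPT}$ be the supremum of the sender's expected utility (under obedience) over all persuasive mechanisms in the benchmark scenario, in which the sender knows all pairs in advance, so that the mechanism may depend on them. *Pareto procedure* on a finite nonempty set $A$ of pairs $(\rho,\xi)$: let $\mu$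 be the average of $\rho$ over $A$. If an element $c\in A$ of maximum $\xi$ has $\rho_c\ge\mu$, put $a=b=c$; otherwise choose $a,b\in A$ such that the segment $[a,b]$ lies in the Pareto frontier (the set of componentwise-maximal points) of the convex hull of $A$ and meets the line $\rho=\mu$ (where several choices are possible, by any fixed rule that depends only on the set $A$). Put $\alpha=1$ if $\rho_a=\rho_b$; $\alpha=0$ if $\rho_a\neq\rho_b$ and $\xi_a=\xi_b$; and $\alpha=\frac{\mu-\rho_b}{\rho_a-\rho_b}$ otherwise. Return $a$ with probability $\alpha$ and $b$ with probability $1-\alpha$. *Growing Pareto mechanism* with sample size $s$ (it does not know the pairs of candidates that have not arrived): signal NOT in rounds $t\le s$, $t<n$. In each round $s<t<n$ apply the Pareto procedure, with fresh randomness, to the set $A_t$ of the pairs of $\theta_1,\dots,\theta_t$, and signal HIRE if and only if it returns $\theta_t$. In round $n$ signal HIRE. After a HIRE signal, signal NOT in all later rounds. **Theorem.** There is a sequence $\varepsilon_n\to 0$, depending only on $n$, such that for every $n\ge1$, all valuations as above and every choice of the rule in the Pareto procedure, the Growing Pareto mechanism with $s=\lfloor n/\sqrt3\rfloor$ is persuasive,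 and its expected sender utility is at least $\left(\frac{1}{3\sqrt3}-\varepsilon_n\right)\mathrm{OPT}$. -/

import Mathlib

open Filter Topology

noncomputable section

open scoped Classical

namespace SecretaryPersuasion

/-- The order in which candidates arrive: `π t` is the candidate arriving in round `t`
(rounds are indexed from `0`). -/
abbrev Order (n : ℕ) := Equiv.Perm (Fin n)

/-- A (randomized) direct mechanism of the sender for `n` rounds. In round `t` it sees the
valuation pairs (receiver value, sender value) of the candidates of rounds `≤ t` and the signals
it sent in rounds `< t`, and signals HIRE with probability `hireProb t _ _` (otherwise NOT).
Signals are Booleans, `true` for HIRE and `false` for NOT. -/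
structure Mechanism (n : ℕ) where
  hireProb : (t : Fin n) → (Set.Iic t → ℝ × ℝ) → (Set.Iio t → Bool) → ℝ
  hireProb_nonneg : ∀ t x h, 0 ≤ hireProb t x h
  hireProb_le_one : ∀ t x h, hireProb t x h ≤ 1

/-- A strategy of the receiver without disclosure: in each round, provided that nobody has been
hired so far, decide (`true` = hire) on the basis of the signals of rounds `≤ t` only. -/
def ReceiverStrategy (n : ℕ) := (t : Fin n) → (Set.Iic t → Bool) → Bool

/-- Obedience: hire exactly upon the signal HIRE. -/
def obedient (n : ℕ) : ReceiverStrategy n := fun t h => h ⟨t, le_refl t⟩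

section Model

variable {n : ℕ}

/-- Probability that the mechanism, run through all rounds without interruption, sends the
signal vector `σ` when the candidates with valuations `(ρ i, ξ i)` arrive in the order `π`. -/
def signalProb (ρ ξ : Fin n → ℝ) (M : Mechanism n) (π : Order n) (σ : Fin n → Bool) : ℝ :=
  ∏ t : Fin n,
    if σ t = true then
      M.hireProb t (fun r => (ρ (π r.1), ξ (π r.1))) (fun r => σ r.1)
    else
      1 - M.hireProb t (fun r => (ρ (π r.1), ξ (π r.1))) (fun r => σ r.1)

/-- Expectation over the uniformly random arrival order and the random signals. -/
def expectation (ρ ξ : Fin n → ℝ) (M : Mechanism n) (F : Order n → (Fin n → Bool) → ℝ) : ℝ :=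
  (∑ π : Order n, ∑ σ : Fin n → Bool, signalProb ρ ξ M π σ * F π σ) / (n.factorial : ℝ)

/-- A receiver who has rejected everybody in the rounds before `k` and uses `d` from round `k` on
hires in round `r`. -/
def HiresAt (d : ReceiverStrategy n) (k : ℕ) (σ : Fin n → Bool) (r : Fin n) : Prop :=
  k ≤ (r : ℕ) ∧ d r (fun q => σ q.1) = true ∧
    ∀ q : Fin n, k ≤ (q : ℕ) → q < r → d q (fun j => σ j.1) = false

/-- The value, under the valuation `v`, of the candidate hired by a receiver who uses `d` from
round `k` on (`0` if nobody is hired). -/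
def hiredValue (v : Fin n → ℝ) (d : ReceiverStrategy n) (k : ℕ) (π : Order n)
    (σ : Fin n → Bool) : ℝ :=
  ∑ r : Fin n, if HiresAt d k σ r then v (π r) else 0

/-- The receiver's information in round `t` if nobody was hired before and she was obedient:
all earlier signals were NOT, and the current signal is `b`. -/
def Observed (t : Fin n) (b : Bool) (σ : Fin n → Bool) : Prop :=
  (∀ r : Fin n, r < t → σ r = false) ∧ σ t = b

/-- Persuasiveness for a receiver who knows all valuations, the mechanism, and that the arrival
order is uniform: in every round `t` reached under obedience, and for both signals `b`, obedience
from then on maximizes her conditional expected utility given the observed signals among all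
continuation strategies. Both sides are multiplied by the probability of the observation, so
that the condition is void exactly for observations of probability zero. -/
def Persuasive (ρ ξ : Fin n → ℝ) (M : Mechanism n) : Prop :=
  ∀ (t : Fin n) (b : Bool) (d : ReceiverStrategy n),
    expectation ρ ξ M (fun π σ => if Observed t b σ then hiredValue ρ d t π σ else 0) ≤
    expectation ρ ξ M
      (fun π σ => if Observed t b σ then hiredValue ρ (obedient n) t π σ else 0)

/-- The sender's expected utility when the receiver is obedient. -/
def senderUtility (ρ ξ : Fin n → ℝ) (M : Mechanism n) : ℝ :=
  expectation ρ ξ M (fun π σ => hiredValue ξ (obedient n) 0 π σ)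

/-- The sender utilities achievable in the basic scenario without disclosure, where the sender
knows the valuations, so that the persuasive mechanism `M` may be tailored to `ρ` and `ξ`. -/
def achievable (ρ ξ : Fin n → ℝ) : Set ℝ :=
  {u | ∃ M : Mechanism n, Persuasive ρ ξ M ∧ u = senderUtility ρ ξ M}

/-- The optimal expected sender utility in the basic scenario without disclosure. -/
def OPT (ρ ξ : Fin n → ℝ) : ℝ := sSup (achievable ρ ξ)

/-- The supremum defining `OPT` is taken over a bounded set. -/
theorem achievable_bddAbove (ρ ξ : Fin n → ℝ) (hξ : ∀ i, 0 ≤ ξ i) :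
    BddAbove (achievable ρ ξ) := by
  refine ⟨(∑ π : Order n, ∑ _σ : Fin n → Bool, ∑ r : Fin n, ξ (π r)) / (n.factorial : ℝ), ?_⟩
  rintro u ⟨M, -, rfl⟩
  unfold senderUtility expectation
  gcongr with π _ σ _
  have hv : hiredValue ξ (obedient n) 0 π σ ≤ ∑ r : Fin n, ξ (π r) := by
    unfold hiredValue
    gcongr with r _
    split_ifs
    · exact le_rfl
    · exact hξ _
  have h0 : 0 ≤ hiredValue ξ (obedient n) 0 π σ := by
    unfold hiredValue
    refine Finset.sum_nonneg fun r _ => ?_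
    split_ifs
    · exact hξ _
    · exact le_rfl
  have hp : signalProb ρ ξ M π σ ≤ 1 := by
    unfold signalProb
    refine Finset.prod_le_one (fun t _ => ?_) (fun t _ => ?_)
    · split_ifs
      · exact M.hireProb_nonneg _ _ _
      · exact sub_nonneg.2 (M.hireProb_le_one _ _ _)
    · split_ifs
      · exact M.hireProb_le_one _ _ _
      · exact sub_le_self _ (M.hireProb_nonneg _ _ _)
  exact (mul_le_of_le_one_left h0 hp).trans hv

end Model

/-! The Pareto procedure. A valuation pair is `(receiver value, sender value)`. -/

/-- The average receiver value of a finite set of valuation pairs. -/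
def avgReceiver (A : Finset (ℝ × ℝ)) : ℝ := (∑ p ∈ A, p.1) / (A.card : ℝ)

/-- The Pareto frontier of the convex hull (maximal points in the componentwise order). -/
def paretoFrontier (A : Finset (ℝ × ℝ)) : Set (ℝ × ℝ) :=
  {p | Maximal (fun q => q ∈ convexHull ℝ (A : Set (ℝ × ℝ))) p}

/-- `c` is a sender-optimal element of `A`. -/
def IsSenderBest (A : Finset (ℝ × ℝ)) (c : ℝ × ℝ) : Prop :=
  c ∈ A ∧ ∀ p ∈ A, p.2 ≤ c.2

/-- `(a, b)` is a pair as determined by the Pareto procedure: if a sender-optimal pair has at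
least average receiver value, it is such a pair, taken twice; otherwise `a` and `b` span a segment
of the Pareto frontier that meets the vertical line at the average receiver value. -/
def IsParetoPair (A : Finset (ℝ × ℝ)) (a b : ℝ × ℝ) : Prop :=
  a ∈ A ∧ b ∈ A ∧
    ((IsSenderBest A a ∧ avgReceiver A ≤ a.1 ∧ b = a) ∨
      ((∀ c, IsSenderBest A c → c.1 < avgReceiver A) ∧
        segment ℝ a b ⊆ paretoFrontier A ∧ ∃ p ∈ segment ℝ a b, p.1 = avgReceiver A))

/-- A rule, depending on the set `A` alone, by which the procedure finds its pair: it selects a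
pair as required whenever there is one. -/
def IsParetoRule (sel : Finset (ℝ × ℝ) → (ℝ × ℝ) × (ℝ × ℝ)) : Prop :=
  ∀ A : Finset (ℝ × ℝ), (∃ a b, IsParetoPair A a b) → IsParetoPair A (sel A).1 (sel A).2

/-- Such rules exist. -/
theorem exists_isParetoRule : ∃ sel, IsParetoRule sel :=
  ⟨fun A => Classical.epsilon fun ab => IsParetoPair A ab.1 ab.2, fun A ⟨a, b, h⟩ =>
    Classical.epsilon_spec (p := fun ab : (ℝ × ℝ) × (ℝ × ℝ) => IsParetoPair A ab.1 ab.2)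
      ⟨(a, b), h⟩⟩

/-- The parameter `α` of the procedure, applied to `A` with selected pair `(a, b)`. -/
def paretoAlpha (A : Finset (ℝ × ℝ)) (a b : ℝ × ℝ) : ℝ :=
  if a.1 = b.1 then 1
  else if a.2 = b.2 then 0
  else (avgReceiver A - b.1) / (a.1 - b.1)

/-- The probability that a uniform sample from `[0, 1]` is at most `α`. -/
def uniformCdf (α : ℝ) : ℝ := max 0 (min 1 α)

/-- The probability that the Pareto procedure, applied to `A`
with selected pair `(a, b)`, returns the pair `c`: it draws `x`
uniformly from `[0, 1]` and returns `a` if `x ≤ α` and `b` otherwise. -/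
def paretoProb (A : Finset (ℝ × ℝ)) (a b c : ℝ × ℝ) : ℝ :=
  (if c = a then uniformCdf (paretoAlpha A a b) else 0) +
    (if c = b then 1 - uniformCdf (paretoAlpha A a b) else 0)

theorem paretoProb_mem (A : Finset (ℝ × ℝ)) (a b c : ℝ × ℝ) :
    0 ≤ paretoProb A a b c ∧ paretoProb A a b c ≤ 1 := by
  have h0 : 0 ≤ uniformCdf (paretoAlpha A a b) := le_max_left _ _
  have h1 : uniformCdf (paretoAlpha A a b) ≤ 1 := max_le zero_le_one (min_le_left _ _)
  unfold paretoProb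
  constructor <;> split_ifs <;> linarith

/-- The Growing Pareto mechanism with sample size `s` and selection rule `sel`. It has no access to the valuations other
than those of the candidates that have arrived. The Fin-index `t` is round number `t + 1`, the
set `A` of valuation pairs seen so far is `Finset.univ.image x`, and each round uses fresh
randomness:
* after an earlier HIRE it signals NOT;
* otherwise, in the last round, it signals HIRE;
* otherwise, in the first `s` rounds, it signals NOT;
* otherwise it signals HIRE iff the Pareto procedure on `A` returns the current candidate. -/
def growingPareto (sel : Finset (ℝ × ℝ) → (ℝ × ℝ) × (ℝ × ℝ)) (n s : ℕ) : Mechanism n where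
  hireProb t x h :=
    if ∃ r, h r = true then 0
    else if (t : ℕ) + 1 = n then 1
    else if (t : ℕ) + 1 ≤ s then 0
    else paretoProb (Finset.univ.image x) (sel (Finset.univ.image x)).1
      (sel (Finset.univ.image x)).2 (x ⟨t, le_refl t⟩)
  hireProb_nonneg t x h := by
    split_ifs <;> first | exact (paretoProb_mem _ _ _ _).1 | norm_num
  hireProb_le_one t x h := by
    split_ifs <;> first | exact (paretoProb_mem _ _ _ _).2 | norm_num

end SecretaryPersuasion

end

/-!
All signals except the first HIRE are NOT, so its position is all the receiver can learn. Given
the set of candidates seen up to round `t`, the arriving one is uniform among them, so HIRE comes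
with probability `1 / t` independently of that set, and then the expected receiver value is at least
the average over the set, hence at least the overall average `m` in expectation. Therefore a
candidate signalled HIRE beats any later candidate, and since the candidate of a fixed round has
mean value `m` overall and at least `m` if HIRE comes no later, it is not worth hiring after a NOT.

An optimal benchmark mechanism induces hiring probabilities whose mean pair has receiver value at
least `m`, because the receiver could hire the first candidate. Such a pair lies below the Pareto
frontier, so `OPT` is at most the sender value `V` of the Pareto procedure on the whole set. On a
random sample of `t` candidates that contains the pair selected on the whole set, mixing this pair
with the best sampled candidate for the receiver shows that the procedure keeps the fraction of `V`
given by the sampled share of the total shortfall below `m`. A triple of candidates is sampled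
with probability `(t choose 3) / (n choose 3)`, and round `t > s` is reached with probability
`s / (t - 1)`, so the mechanism guarantees `∑ s / (t - 1) * (1 / t) * (t / n) ^ 3`, which
tends to `1 / (3 √3)` for `s = n / √3`.
-/

namespace SecretaryPersuasion

open Finset
open scoped BigOperators

section Pareto

variable {A : Finset (ℝ × ℝ)} {a b q : ℝ × ℝ}

/-- The expected pair returned by the Pareto procedure on `A` with selected pair `(a, b)`. -/
noncomputable def paretoMean (A : Finset (ℝ × ℝ)) (a b : ℝ × ℝ) : ℝ × ℝ :=
  uniformCdf (paretoAlpha A a b) • a + (1 - uniformCdf (paretoAlpha A a b)) • b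

theorem uniformCdf_of_mem_Icc {α : ℝ} (hα : α ∈ Set.Icc 0 1) : uniformCdf α = α := by
  rw [uniformCdf, min_eq_right hα.2, max_eq_right hα.1]

theorem sum_paretoProb_smul (ha : a ∈ A) (hb : b ∈ A) :
    ∑ c ∈ A, paretoProb A a b c • c = paretoMean A a b := by
  simp only [paretoProb, add_smul, ite_smul, zero_smul, sum_add_distrib, sum_ite_eq', ha, hb,
    if_true, paretoMean]

theorem sum_paretoProb (ha : a ∈ A) (hb : b ∈ A) : ∑ c ∈ A, paretoProb A a b c = 1 := by
  simp only [paretoProb, sum_add_distrib, sum_ite_eq', ha, hb, if_true, add_sub_cancel]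

theorem paretoMean_self (A : Finset (ℝ × ℝ)) (a : ℝ × ℝ) : paretoMean A a a = a := by
  rw [paretoMean, ← add_smul, add_sub_cancel, one_smul]

theorem eq_of_segment_subset_paretoFrontier (h : segment ℝ a b ⊆ paretoFrontier A)
    (hab : a.1 = b.1 ∨ a.2 = b.2) : a = b := by
  have ha := h (left_mem_segment ℝ a b)
  have hb := h (right_mem_segment ℝ a b)
  have hcomparable : a ≤ b ∨ b ≤ a := by
    simp only [Prod.le_def]
    rcases hab with hab | hab
    · exact (le_total a.2 b.2).imp (⟨hab.le, ·⟩) (⟨hab.ge, ·⟩)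
    · exact (le_total a.1 b.1).imp (⟨·, hab.le⟩) (⟨·, hab.ge⟩)
  exact hcomparable.elim (fun hle => ha.eq_of_le hb.prop hle)
    fun hle => (hb.eq_of_le ha.prop hle).symm

theorem paretoMean_eq_of_mem_segment (h : segment ℝ a b ⊆ paretoFrontier A)
    (hq : q ∈ segment ℝ a b) (hqA : q.1 = avgReceiver A) : paretoMean A a b = q := by
  by_cases hab : a.1 = b.1 ∨ a.2 = b.2
  · obtain rfl := eq_of_segment_subset_paretoFrontier h hab
    rw [segment_same] at hq
    rw [paretoMean_self, hq]
  · push Not at hab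
    obtain ⟨u, w, hu, hw, huw, rfl⟩ := hq
    obtain rfl : w = 1 - u := eq_sub_of_add_eq' huw
    have hα : paretoAlpha A a b = u := by
      rw [paretoAlpha, if_neg hab.1, if_neg hab.2, ← hqA, div_eq_iff (sub_ne_zero.2 hab.1)]
      simp only [Prod.fst_add, Prod.smul_fst, smul_eq_mul]
      ring
    rw [paretoMean, hα, uniformCdf_of_mem_Icc ⟨hu, sub_nonneg.1 hw⟩]

theorem IsParetoPair.avgReceiver_le (h : IsParetoPair A a b) :
    avgReceiver A ≤ (paretoMean A a b).1 := by
  obtain ⟨-, -, ⟨-, hle, rfl⟩ | ⟨-, hseg, p, hp, hpA⟩⟩ := h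
  · rwa [paretoMean_self]
  · rw [paretoMean_eq_of_mem_segment hseg hp hpA, hpA]

theorem IsParetoPair.snd_le (h : IsParetoPair A a b) (hq : q ∈ convexHull ℝ (A : Set (ℝ × ℝ)))
    (hqA : avgReceiver A ≤ q.1) : q.2 ≤ (paretoMean A a b).2 := by
  obtain ⟨-, -, ⟨hbest, -, rfl⟩ | ⟨-, hseg, p, hp, hpA⟩⟩ := h
  · rw [paretoMean_self]
    exact convexHull_min hbest.2 (convex_halfSpace_le (LinearMap.snd ℝ ℝ ℝ).isLinear b.2) hq
  · rw [paretoMean_eq_of_mem_segment hseg hp hpA]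
    by_contra! hlt
    exact hlt.not_ge ((hseg hp).le_of_ge hq ⟨hpA.trans_le hqA, hlt.le⟩).2

theorem maximal_of_strictMono {α β : Type*} [Preorder α] [Preorder β] {P : α → Prop} {f : α → β}
    (hf : StrictMono f) {x : α} (hx : P x) (hmax : ∀ y, P y → f y ≤ f x) : Maximal P x :=
  ⟨hx, fun y hy hxy => by
    by_contra hyx
    exact (hmax y hy).not_gt (hf (hxy.lt_of_not_ge hyx))⟩

theorem segment_subset_paretoFrontier {f : ℝ × ℝ →ₗ[ℝ] ℝ} (hf : StrictMono f) (ha : a ∈ A)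
    (hb : b ∈ A) (hab : f a = f b) (hmax : ∀ p ∈ A, f p ≤ f b) :
    segment ℝ a b ⊆ paretoFrontier A := by
  intro p hp
  have hfp : f p = f b := (convex_hyperplane f.isLinear (f b)).segment_subset hab rfl hp
  refine maximal_of_strictMono hf (segment_subset_convexHull ha hb hp) fun q hq => ?_
  exact hfp ▸ convexHull_min hmax (convex_halfSpace_le f.isLinear (f b)) hq

/-- The linear functional with level lines of slope `-l` in the (receiver, sender) plane. -/
noncomputable def levelFunctional (l : ℝ) : ℝ × ℝ →ₗ[ℝ] ℝ :=
  LinearMap.snd ℝ ℝ ℝ + l • LinearMap.fst ℝ ℝ ℝ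

theorem levelFunctional_apply (l : ℝ) (p : ℝ × ℝ) : levelFunctional l p = p.2 + l * p.1 := rfl

theorem levelFunctional_strictMono {l : ℝ} (hl : 0 < l) : StrictMono (levelFunctional l) := by
  intro p q hpq
  simp only [levelFunctional_apply]
  rcases Prod.lt_iff.1 hpq with ⟨h₁, h₂⟩ | ⟨h₁, h₂⟩
  · exact add_lt_add_of_le_of_lt h₂ (mul_lt_mul_of_pos_left h₁ hl)
  · exact add_lt_add_of_lt_of_le h₂ (mul_le_mul_of_nonneg_left h₁ hl.le)

/-- The line is the steepest among the lines that leave a point of `L` and support `R` from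
above. -/
theorem exists_supporting_line {L R : Finset (ℝ × ℝ)} (hR : R.Nonempty)
    (hLR : ∀ a ∈ L, ∀ b ∈ R, a.1 < b.1) (htop : ∃ c ∈ L, ∀ b ∈ R, b.2 < c.2) :
    ∃ l > 0, ∃ a ∈ L, ∃ b ∈ R, levelFunctional l a = levelFunctional l b ∧
      ∀ p ∈ L ∪ R, levelFunctional l p ≤ levelFunctional l b := by
  let slope (a b : ℝ × ℝ) : ℝ := (a.2 - b.2) / (b.1 - a.1)
  have hslope_le {a b : ℝ × ℝ} (h : a.1 < b.1) (l : ℝ) :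
      slope a b ≤ l ↔ levelFunctional l a ≤ levelFunctional l b := by
    simp only [slope, div_le_iff₀ (sub_pos.2 h), levelFunctional_apply]
    constructor <;> intro <;> linarith
  have hle_slope {a b : ℝ × ℝ} (h : a.1 < b.1) (l : ℝ) :
      l ≤ slope a b ↔ levelFunctional l b ≤ levelFunctional l a := by
    simp only [slope, le_div_iff₀ (sub_pos.2 h), levelFunctional_apply]
    constructor <;> intro <;> linarith
  choose nearest hnearest hmin using fun a => R.exists_min_image (slope a) hR
  obtain ⟨c, hc, hcR⟩ := htop
  obtain ⟨a, ha, hmax⟩ := L.exists_max_image (fun a => slope a (nearest a)) ⟨c, hc⟩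
  have hpos : 0 < slope a (nearest a) :=
    (div_pos (sub_pos.2 (hcR _ (hnearest c))) (sub_pos.2 (hLR c hc _ (hnearest c)))).trans_le
      (hmax c hc)
  have hlt := hLR a ha _ (hnearest a)
  have heq := ((hslope_le hlt _).1 le_rfl).antisymm ((hle_slope hlt _).1 le_rfl)
  have hleR : ∀ p ∈ R, levelFunctional (slope a (nearest a)) p ≤
      levelFunctional (slope a (nearest a)) (nearest a) := fun p hp =>
    heq ▸ (hle_slope (hLR a ha p hp) _).1 (hmin a p hp)
  refine ⟨_, hpos, a, ha, nearest a, hnearest a, heq, fun p hp => ?_⟩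
  rcases mem_union.1 hp with hp | hp
  · exact ((hslope_le (hLR p hp _ (hnearest p)) _).1 (hmax p hp)).trans (hleR _ (hnearest p))
  · exact hleR p hp

theorem exists_mem_segment_fst_eq {m : ℝ} (ha : a.1 ≤ m) (hb : m ≤ b.1) :
    ∃ p ∈ segment ℝ a b, p.1 = m := by
  have hm : m ∈ LinearMap.fst ℝ ℝ ℝ '' segment ℝ a b := by
    rw [← LinearMap.coe_toAffineMap, image_segment]
    exact segment_eq_Icc (ha.trans hb) ▸ ⟨ha, hb⟩
  exact hm

theorem avgReceiver_eq_expect (A : Finset (ℝ × ℝ)) : avgReceiver A = 𝔼 p ∈ A, p.1 :=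
  (expect_eq_sum_div_card A _).symm

theorem exists_avgReceiver_le (hA : A.Nonempty) : ∃ p ∈ A, avgReceiver A ≤ p.1 := by
  rw [avgReceiver_eq_expect]
  exact exists_le_of_expect_le_expect hA (expect_const hA _).le

theorem exists_isParetoPair (hA : A.Nonempty) : ∃ a b, IsParetoPair A a b := by
  by_cases hc : ∃ c, IsSenderBest A c ∧ avgReceiver A ≤ c.1
  · obtain ⟨c, hbest, hle⟩ := hc
    exact ⟨c, c, hbest.1, hbest.1, Or.inl ⟨hbest, hle, rfl⟩⟩
  push Not at hc
  obtain ⟨c, hcA, hcmax⟩ := A.exists_max_image Prod.snd hA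
  obtain ⟨d, hdA, hd⟩ := exists_avgReceiver_le hA
  obtain ⟨l, hl, a, ha, b, hb, hab, hmax⟩ := exists_supporting_line
    (L := {p ∈ A | p.1 < avgReceiver A}) (R := {p ∈ A | ¬p.1 < avgReceiver A})
    ⟨d, mem_filter.2 ⟨hdA, hd.not_gt⟩⟩
    (fun a ha b hb => (mem_filter.1 ha).2.trans_le (not_lt.1 (mem_filter.1 hb).2))
    ⟨c, mem_filter.2 ⟨hcA, hc c ⟨hcA, hcmax⟩⟩, fun b hb => (hcmax b (mem_filter.1 hb).1).lt_of_ne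
      fun heq => (mem_filter.1 hb).2 (hc b ⟨(mem_filter.1 hb).1, heq ▸ hcmax⟩)⟩
  rw [filter_union_filter_not_eq] at hmax
  rw [mem_filter] at ha hb
  exact ⟨a, b, ha.1, hb.1, Or.inr ⟨hc,
    segment_subset_paretoFrontier (levelFunctional_strictMono hl) ha.1 hb.1 hab hmax,
    exists_mem_segment_fst_eq ha.2.le (not_lt.1 hb.2)⟩⟩

end Pareto

section Rule

variable {A : Finset (ℝ × ℝ)} {sel : Finset (ℝ × ℝ) → (ℝ × ℝ) × (ℝ × ℝ)}

/-- The probability that the Pareto procedure with selection rule `sel` returns `c` on `A`. -/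
noncomputable def ruleProb (sel : Finset (ℝ × ℝ) → (ℝ × ℝ) × (ℝ × ℝ)) (A : Finset (ℝ × ℝ))
    (c : ℝ × ℝ) : ℝ :=
  paretoProb A (sel A).1 (sel A).2 c

/-- The expected pair returned by the Pareto procedure with selection rule `sel` on `A`. -/
noncomputable def ruleMean (sel : Finset (ℝ × ℝ) → (ℝ × ℝ) × (ℝ × ℝ)) (A : Finset (ℝ × ℝ)) :
    ℝ × ℝ :=
  paretoMean A (sel A).1 (sel A).2

theorem IsParetoRule.isParetoPair (hsel : IsParetoRule sel) (hA : A.Nonempty) :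
    IsParetoPair A (sel A).1 (sel A).2 :=
  hsel A (exists_isParetoPair hA)

theorem IsParetoRule.sum_ruleProb (hsel : IsParetoRule sel) (hA : A.Nonempty) :
    ∑ c ∈ A, ruleProb sel A c = 1 :=
  sum_paretoProb (hsel.isParetoPair hA).1 (hsel.isParetoPair hA).2.1

theorem IsParetoRule.sum_ruleProb_smul (hsel : IsParetoRule sel) (hA : A.Nonempty) :
    ∑ c ∈ A, ruleProb sel A c • c = ruleMean sel A :=
  sum_paretoProb_smul (hsel.isParetoPair hA).1 (hsel.isParetoPair hA).2.1

theorem IsParetoRule.avgReceiver_le (hsel : IsParetoRule sel) (hA : A.Nonempty) :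
    avgReceiver A ≤ (ruleMean sel A).1 :=
  (hsel.isParetoPair hA).avgReceiver_le

theorem IsParetoRule.snd_le (hsel : IsParetoRule sel) {q : ℝ × ℝ}
    (hq : q ∈ convexHull ℝ (A : Set (ℝ × ℝ))) (hqA : avgReceiver A ≤ q.1) :
    q.2 ≤ (ruleMean sel A).2 :=
  (hsel.isParetoPair (coe_nonempty.1 (convexHull_nonempty_iff.1 ⟨q, hq⟩))).snd_le hq hqA

theorem IsParetoRule.snd_ruleMean_nonneg (hsel : IsParetoRule sel) (hA : A.Nonempty)
    (hnonneg : ∀ p ∈ A, 0 ≤ p.2) : 0 ≤ (ruleMean sel A).2 := by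
  obtain ⟨p, hp, hle⟩ := exists_avgReceiver_le hA
  exact (hnonneg p hp).trans (hsel.snd_le (subset_convexHull ℝ _ hp) hle)

end Rule

section RandomOrder

variable {n : ℕ}

/-- The candidates that arrive in the rounds up to `t`. -/
def arrived (π : Order n) (t : Fin n) : Finset (Fin n) := (Iic t).map π.toEmbedding

/-- The quantity `F` does not change when the candidates of the rounds before `k` are rearranged
among these rounds. -/
def InvariantBefore (k : ℕ) (F : Order n → ℝ) : Prop :=
  ∀ π τ : Order n, (∀ j : Fin n, k ≤ j → τ j = j) → F (π * τ) = F π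

theorem InvariantBefore.mono {k l : ℕ} {F : Order n → ℝ} (hF : InvariantBefore l F)
    (hkl : k ≤ l) : InvariantBefore k F :=
  fun π τ hτ => hF π τ fun j hj => hτ j (hkl.trans hj)

theorem InvariantBefore.mul {k : ℕ} {F G : Order n → ℝ} (hF : InvariantBefore k F)
    (hG : InvariantBefore k G) : InvariantBefore k fun π => F π * G π :=
  fun π τ hτ => congrArg₂ (· * ·) (hF π τ hτ) (hG π τ hτ)

theorem InvariantBefore.one_sub {k : ℕ} {F : Order n → ℝ} (hF : InvariantBefore k F) :
    InvariantBefore k fun π => 1 - F π :=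
  fun π τ hτ => congrArg (1 - ·) (hF π τ hτ)

theorem invariantBefore_const (k : ℕ) (c : ℝ) : InvariantBefore (n := n) k fun _ => c :=
  fun _ _ _ => rfl

theorem invariantBefore_apply (v : Fin n → ℝ) {k : ℕ} {j : Fin n} (hj : k ≤ j) :
    InvariantBefore k fun π => v (π j) :=
  fun π _ hτ => congrArg (fun i => v (π i)) (hτ j hj)

theorem card_arrived (π : Order n) (t : Fin n) : #(arrived π t) = t + 1 := by
  rw [arrived, card_map, Fin.card_Iic]

theorem arrived_nonempty (π : Order n) (t : Fin n) : (arrived π t).Nonempty :=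
  nonempty_Iic.map

theorem arrived_mul {π τ : Order n} {t : Fin n} (hτ : ∀ j : Fin n, t + 1 ≤ (j : ℕ) → τ j = j) :
    arrived (π * τ) t = arrived π t := by
  have hmap : (Iic t).map τ.toEmbedding = Iic t :=
    map_perm fun j hj => mem_coe.2 (mem_Iic.2 (not_lt.1 fun hlt => hj (hτ j hlt)))
  rw [arrived, arrived, ← congrArg (Finset.map π.toEmbedding) hmap, Finset.map_map]
  rfl

theorem invariantBefore_arrived (Φ : Finset (Fin n) → ℝ) (t : Fin n) :
    InvariantBefore (t + 1) fun π => Φ (arrived π t) :=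
  fun _ _ hτ => congrArg Φ (arrived_mul hτ)

/-- Given the set of candidates that have arrived, the current one is uniformly distributed. -/
theorem expect_apply_current {t : Fin n} {G : Order n → Fin n → ℝ}
    (hG : ∀ i, InvariantBefore (t + 1) fun π => G π i) :
    𝔼 π, G π (π t) = 𝔼 π, 𝔼 i ∈ arrived π t, G π i := by
  have hswap : ∀ j ∈ Iic t, 𝔼 π, G π (π j) = 𝔼 π, G π (π t) := fun j hj =>
    Fintype.expect_equiv (Equiv.mulRight (Equiv.swap j t)) _ _ fun π => by
      have hfix : ∀ i : Fin n, t + 1 ≤ (i : ℕ) → Equiv.swap j t i = i := fun i hi =>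
        Equiv.swap_apply_of_ne_of_ne ((mem_Iic.1 hj).trans_lt hi).ne' (Fin.ne_of_gt hi)
      simp only [Equiv.coe_mulRight, hG _ _ _ hfix, Equiv.Perm.mul_apply, Equiv.swap_apply_right]
  calc 𝔼 π, G π (π t) = 𝔼 j ∈ Iic t, 𝔼 π, G π (π j) := by
        rw [expect_congr rfl hswap, expect_const nonempty_Iic]
    _ = 𝔼 π, 𝔼 j ∈ Iic t, G π (π j) := expect_comm _ _ _
    _ = 𝔼 π, 𝔼 i ∈ arrived π t, G π i := by
        refine expect_congr rfl fun π _ => ?_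
        rw [arrived, map_eq_image, expect_image π.toEmbedding.injective.injOn]
        rfl

theorem expect_apply (v : Fin n → ℝ) (j : Fin n) : 𝔼 π : Order n, v (π j) = 𝔼 i, v i := by
  have hswap (i : Fin n) : 𝔼 π : Order n, v (π i) = 𝔼 π : Order n, v (π j) :=
    Fintype.expect_equiv (Equiv.mulRight (Equiv.swap i j)) _ _ fun π => by
      simp only [Equiv.coe_mulRight, Equiv.Perm.mul_apply, Equiv.swap_apply_right]
  calc 𝔼 π : Order n, v (π j) = 𝔼 i, 𝔼 π : Order n, v (π i) := by
        rw [expect_congr rfl fun i _ => hswap i, expect_const ⟨j, mem_univ j⟩]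
    _ = 𝔼 π : Order n, 𝔼 i, v (π i) := expect_comm _ _ _
    _ = 𝔼 i, v i := by
        rw [expect_congr rfl fun π _ => Fintype.expect_equiv π (fun i => v (π i)) v fun _ => rfl,
          Fintype.expect_const]

end RandomOrder

section GrowingProcess

variable {n : ℕ} {sel : Finset (ℝ × ℝ) → (ℝ × ℝ) × (ℝ × ℝ)} {s : ℕ} {x : Fin n → ℝ × ℝ}
  {t : Fin n}

/-- The probability that the Growing Pareto mechanism signals HIRE in round `t` after NOT signals
in all earlier rounds. -/
noncomputable def condHireProb (sel : Finset (ℝ × ℝ) → (ℝ × ℝ) × (ℝ × ℝ)) (s : ℕ)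
    (x : Fin n → ℝ × ℝ) (π : Order n) (t : Fin n) : ℝ :=
  if (t : ℕ) + 1 = n then 1
  else if (t : ℕ) + 1 ≤ s then 0
  else ruleProb sel ((arrived π t).image x) (x (π t))

/-- The average of `condHireProb` over all arrival orders. -/
noncomputable def hireRate (n s t : ℕ) : ℝ :=
  if t + 1 = n then 1 else if t + 1 ≤ s then 0 else 1 / (t + 1)

/-- The probability that the first HIRE signal comes in round `r`. -/
noncomputable def firstHireProb (sel : Finset (ℝ × ℝ) → (ℝ × ℝ) × (ℝ × ℝ)) (s : ℕ)
    (x : Fin n → ℝ × ℝ) (π : Order n) (r : Fin n) : ℝ :=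
  (∏ q ∈ Iio r, (1 - condHireProb sel s x π q)) * condHireProb sel s x π r

theorem condHireProb_mem_Icc (π : Order n) (t : Fin n) :
    condHireProb sel s x π t ∈ Set.Icc 0 1 := by
  unfold condHireProb
  split_ifs
  · exact ⟨zero_le_one, le_rfl⟩
  · exact ⟨le_rfl, zero_le_one⟩
  · exact paretoProb_mem _ _ _ _

theorem firstHireProb_nonneg (π : Order n) (r : Fin n) : 0 ≤ firstHireProb sel s x π r :=
  mul_nonneg (prod_nonneg fun q _ => sub_nonneg.2 (condHireProb_mem_Icc π q).2)
    (condHireProb_mem_Icc π r).1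

theorem sum_firstHireProb (hn : 1 ≤ n) (π : Order n) : ∑ r, firstHireProb sel s x π r = 1 := by
  let last : Fin n := ⟨n - 1, Nat.sub_one_lt_of_lt hn⟩
  have hlast : condHireProb sel s x π last = 1 := if_pos (Nat.sub_add_cancel hn)
  have hprod := prod_one_sub_ordered univ (condHireProb sel s x π)
  rw [prod_eq_zero (mem_univ last) (sub_eq_zero.2 hlast.symm)] at hprod
  calc ∑ r, firstHireProb sel s x π r
      = ∑ r, condHireProb sel s x π r * ∏ q with q < r, (1 - condHireProb sel s x π q) :=
        sum_congr rfl fun r _ => by rw [firstHireProb, mul_comm, filter_gt_eq_Iio]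
    _ = 1 := (sub_eq_zero.1 hprod.symm).symm

theorem invariantBefore_condHireProb (t : Fin n) :
    InvariantBefore t fun π => condHireProb sel s x π t := fun π τ hτ => by
  simp only [condHireProb, arrived_mul fun j hj => hτ j (Nat.le_of_succ_le hj),
    Equiv.Perm.mul_apply, hτ t le_rfl]

theorem expect_ruleProb_image (hsel : IsParetoRule sel) (hx : Function.Injective x)
    {I : Finset (Fin n)} (hI : I.Nonempty) :
    𝔼 i ∈ I, ruleProb sel (I.image x) (x i) = 1 / #I := by
  rw [expect_eq_sum_div_card, ← sum_image (f := ruleProb sel (I.image x)) hx.injOn,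
    hsel.sum_ruleProb (hI.image x)]

theorem expect_ruleProb_image_mul (hsel : IsParetoRule sel) (hx : Function.Injective x)
    {I : Finset (Fin n)} (hI : I.Nonempty) (f : ℝ × ℝ →ₗ[ℝ] ℝ) :
    𝔼 i ∈ I, ruleProb sel (I.image x) (x i) * f (x i) =
      1 / #I * f (ruleMean sel (I.image x)) := by
  rw [← hsel.sum_ruleProb_smul (hI.image x), map_sum, sum_image hx.injOn,
    expect_eq_sum_div_card, one_div_mul_eq_div]
  simp only [map_smul, smul_eq_mul]

theorem expect_condHireProb_mul (hsel : IsParetoRule sel) (hx : Function.Injective x)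
    {F : Order n → ℝ} (hF : InvariantBefore (t + 1) F) :
    𝔼 π, condHireProb sel s x π t * F π = hireRate n s t * 𝔼 π, F π := by
  unfold condHireProb hireRate
  split_ifs
  · simp only [one_mul]
  · simp only [zero_mul, expect_const_zero]
  · rw [expect_apply_current (G := fun π i => ruleProb sel ((arrived π t).image x) (x i) * F π)
      fun i => (invariantBefore_arrived (fun I => ruleProb sel (I.image x) (x i)) t).mul hF]
    simp only [← expect_mul, expect_ruleProb_image hsel hx (arrived_nonempty _ t), card_arrived,
      Nat.cast_add_one, mul_expect]

theorem expect_condHireProb_mul_current (hsel : IsParetoRule sel) (hx : Function.Injective x)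
    (hs : s ≤ t) (ht : (t : ℕ) + 1 < n) (f : ℝ × ℝ →ₗ[ℝ] ℝ) :
    𝔼 π, condHireProb sel s x π t * f (x (π t)) =
      1 / (t + 1) * 𝔼 π, f (ruleMean sel ((arrived π t).image x)) := by
  simp only [condHireProb, if_neg ht.ne, if_neg (Nat.lt_succ_of_le hs).not_ge]
  rw [expect_apply_current
    (G := fun π i => ruleProb sel ((arrived π t).image x) (x i) * f (x i)) fun i =>
      invariantBefore_arrived (fun I => ruleProb sel (I.image x) (x i) * f (x i)) t]
  simp only [expect_ruleProb_image_mul hsel hx (arrived_nonempty _ t), card_arrived,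
    Nat.cast_add_one, mul_expect]

theorem avgReceiver_image (hx : Function.Injective x) (I : Finset (Fin n)) :
    avgReceiver (I.image x) = 𝔼 i ∈ I, (x i).1 := by
  rw [avgReceiver_eq_expect, expect_image hx.injOn]

theorem expect_avgReceiver_arrived (hx : Function.Injective x) (t : Fin n) :
    𝔼 π, avgReceiver ((arrived π t).image x) = 𝔼 i, (x i).1 := by
  simp only [avgReceiver_image hx]
  rw [← expect_apply_current (G := fun _ i => (x i).1) fun i => invariantBefore_const _ _,
    expect_apply fun i => (x i).1]

theorem hireRate_mul_le_expect_condHireProb (hsel : IsParetoRule sel) (hx : Function.Injective x)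
    (t : Fin n) :
    hireRate n s t * 𝔼 i, (x i).1 ≤ 𝔼 π, condHireProb sel s x π t * (x (π t)).1 := by
  by_cases hlast : (t : ℕ) + 1 = n
  · simp only [hireRate, condHireProb, if_pos hlast, one_mul, expect_apply fun i => (x i).1,
      le_refl]
  by_cases hsample : (t : ℕ) + 1 ≤ s
  · simp only [hireRate, condHireProb, if_neg hlast, if_pos hsample, zero_mul, expect_const_zero,
      le_refl]
  have hcurrent : 𝔼 π, condHireProb sel s x π t * (x (π t)).1 =
      1 / (t + 1) * 𝔼 π, (ruleMean sel ((arrived π t).image x)).1 :=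
    expect_condHireProb_mul_current hsel hx (Nat.lt_succ_iff.1 (not_le.1 hsample))
      (lt_of_le_of_ne t.2 hlast) (LinearMap.fst ℝ ℝ ℝ)
  rw [hireRate, if_neg hlast, if_neg hsample, hcurrent, ← expect_avgReceiver_arrived hx t]
  gcongr with π
  exact hsel.avgReceiver_le ((arrived_nonempty π t).image x)

theorem hireRate_le_one (n s t : ℕ) : hireRate n s t ≤ 1 := by
  unfold hireRate
  split_ifs
  · exact le_rfl
  · exact zero_le_one
  · exact div_le_one_of_le₀ (le_add_of_nonneg_left t.cast_nonneg) (by positivity)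

theorem Iio_mk_zero (h : 0 < n) : Iio (⟨0, h⟩ : Fin n) = ∅ :=
  Finset.Iio_eq_empty.2 (fun _ _ => Fin.le_def.2 (Nat.zero_le _))

theorem prod_Iio_succ (f : Fin n → ℝ) {k : ℕ} (hk : k + 1 < n) :
    ∏ q ∈ Iio (⟨k + 1, hk⟩ : Fin n), f q =
      (∏ q ∈ Iio (⟨k, Nat.lt_of_succ_lt hk⟩ : Fin n), f q) * f ⟨k, Nat.lt_of_succ_lt hk⟩ := by
  rw [prod_Iio_mul_eq_prod_Iic]
  refine prod_congr (ext fun q => ?_) fun _ _ => rfl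
  simp only [mem_Iio, mem_Iic, Fin.lt_def, Fin.le_def, Nat.lt_succ_iff]

/-- Having seen only NOT signals carries no information about the set of candidates that have
arrived, nor about the later arrivals. -/
theorem expect_prod_one_sub_condHireProb_mul (hsel : IsParetoRule sel)
    (hx : Function.Injective x) {F : Order n → ℝ} (hF : InvariantBefore t F) :
    𝔼 π, (∏ q ∈ Iio t, (1 - condHireProb sel s x π q)) * F π =
      (∏ q ∈ Iio t, (1 - hireRate n s q)) * 𝔼 π, F π := by
  obtain ⟨k, hk⟩ := t
  induction k generalizing F with
  | zero => simp only [Iio_mk_zero, prod_empty, one_mul]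
  | succ k ih =>
    have hF' := hF.mono k.le_succ
    simp only [prod_Iio_succ _ hk, mul_assoc]
    rw [ih _ ((invariantBefore_condHireProb _).one_sub.mul hF')]
    simp only [sub_mul, one_mul, expect_sub_distrib,
      expect_condHireProb_mul (t := ⟨k, Nat.lt_of_succ_lt hk⟩) hsel hx hF]

theorem max_mul_prod_one_sub_hireRate (s : ℕ) (t : Fin n) :
    ((max s t : ℕ) : ℝ) * ∏ q ∈ Iio t, (1 - hireRate n s q) = s := by
  obtain ⟨k, hk⟩ := t
  induction k with
  | zero => rw [Iio_mk_zero, prod_empty, mul_one, Nat.max_zero]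
  | succ k ih =>
    have hprod := ih (Nat.lt_of_succ_lt hk)
    have hrate : hireRate n s k = if k + 1 ≤ s then 0 else 1 / ((k : ℝ) + 1) := if_neg hk.ne
    rw [prod_Iio_succ _ hk, hrate]
    dsimp only at hprod ⊢
    split_ifs with hks
    · rw [max_eq_left (Nat.le_of_succ_le hks)] at hprod
      rwa [max_eq_left hks, sub_zero, mul_one]
    · have hs : s ≤ k := Nat.lt_succ_iff.1 (not_le.1 hks)
      rw [max_eq_right hs] at hprod
      rw [max_eq_right (hs.trans k.le_succ), Nat.cast_add_one, ← hprod]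
      field_simp
      ring

theorem div_le_prod_one_sub_hireRate (hs : s ≤ t) :
    (s : ℝ) / t ≤ ∏ q ∈ Iio t, (1 - hireRate n s q) := by
  refine div_le_of_le_mul₀ t.1.cast_nonneg
    (prod_nonneg fun q _ => sub_nonneg.2 (hireRate_le_one n s q)) ?_
  have hprod := max_mul_prod_one_sub_hireRate s t
  rw [max_eq_right hs, mul_comm] at hprod
  exact hprod.ge

theorem expect_firstHireProb_mul (hsel : IsParetoRule sel) (hx : Function.Injective x)
    {F : Order n → ℝ} (hF : InvariantBefore t F) :
    𝔼 π, firstHireProb sel s x π t * F π =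
      (∏ q ∈ Iio t, (1 - hireRate n s q)) * 𝔼 π, condHireProb sel s x π t * F π := by
  simp only [firstHireProb, mul_assoc]
  rw [expect_prod_one_sub_condHireProb_mul hsel hx ((invariantBefore_condHireProb t).mul hF)]

theorem expect_firstHireProb_mul_of_lt (hsel : IsParetoRule sel) (hx : Function.Injective x)
    {r j : Fin n} (hrj : r < j) (v : Fin n → ℝ) :
    𝔼 π, firstHireProb sel s x π r * v (π j) =
      (𝔼 π, firstHireProb sel s x π r) * 𝔼 i, v i := by
  have hmul {F : Order n → ℝ} (hF : InvariantBefore (r + 1) F) :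
      𝔼 π, firstHireProb sel s x π r * F π =
        (∏ q ∈ Iio r, (1 - hireRate n s q)) * (hireRate n s r * 𝔼 π, F π) := by
    rw [expect_firstHireProb_mul hsel hx (hF.mono r.1.le_succ), expect_condHireProb_mul hsel hx hF]
  have hone := hmul (invariantBefore_const (r + 1) 1)
  simp only [mul_one, Fintype.expect_one] at hone
  rw [hmul (invariantBefore_apply v hrj), expect_apply, hone]
  ring

theorem expect_firstHireProb_mul_avg_le (hsel : IsParetoRule sel) (hx : Function.Injective x)
    (r : Fin n) :
    (𝔼 π, firstHireProb sel s x π r) * 𝔼 i, (x i).1 ≤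
      𝔼 π, firstHireProb sel s x π r * (x (π r)).1 := by
  have hone := expect_firstHireProb_mul (s := s) hsel hx (invariantBefore_const r 1)
  rw [expect_condHireProb_mul hsel hx (invariantBefore_const _ 1)] at hone
  simp only [mul_one, Fintype.expect_one] at hone
  rw [hone, expect_firstHireProb_mul hsel hx (invariantBefore_apply (fun i => (x i).1) le_rfl),
    mul_assoc]
  gcongr
  · exact prod_nonneg fun q _ => sub_nonneg.2 (hireRate_le_one n s q)
  · exact hireRate_mul_le_expect_condHireProb hsel hx r

/-- On average over the possible first HIRE rounds the candidate of round `q` has the mean value,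
and at least the mean value if the first HIRE comes in a round up to `q`; so a HIRE signal after
round `q` is bad news about that candidate. -/
theorem sum_Ioi_expect_firstHireProb_mul_le (hsel : IsParetoRule sel) (hx : Function.Injective x)
    (q : Fin n) :
    ∑ r ∈ Ioi q, 𝔼 π, firstHireProb sel s x π r * (x (π q)).1 ≤
      ∑ r ∈ Ioi q, 𝔼 π, firstHireProb sel s x π r * (x (π r)).1 := by
  have hn : 1 ≤ n := q.pos
  set m := 𝔼 i, (x i).1
  have hsplit (f : Fin n → ℝ) : ∑ r ∈ Ioi q, f r = ∑ r, f r - ∑ r ∈ Iic q, f r := by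
    rw [show Ioi q = (Iic q)ᶜ by ext; simp only [mem_Ioi, mem_compl, mem_Iic, not_le],
      eq_sub_iff_add_eq, sum_compl_add_sum]
  have htotal : ∑ r, 𝔼 π, firstHireProb sel s x π r * (x (π q)).1 = m := by
    simp only [← expect_sum_comm, ← sum_mul, sum_firstHireProb hn, one_mul]
    exact expect_apply (fun i => (x i).1) q
  have htotal_one : ∑ r, 𝔼 π, firstHireProb sel s x π r = 1 := by
    simp only [← expect_sum_comm, sum_firstHireProb hn, Fintype.expect_one]
  have hearly : ∀ r ∈ Iic q, (𝔼 π, firstHireProb sel s x π r) * m ≤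
      𝔼 π, firstHireProb sel s x π r * (x (π q)).1 := fun r hr => by
    rcases (mem_Iic.1 hr).eq_or_lt with rfl | hlt
    · exact expect_firstHireProb_mul_avg_le hsel hx r
    · exact (expect_firstHireProb_mul_of_lt hsel hx hlt fun i => (x i).1).ge
  calc ∑ r ∈ Ioi q, 𝔼 π, firstHireProb sel s x π r * (x (π q)).1
      ≤ m - ∑ r ∈ Iic q, (𝔼 π, firstHireProb sel s x π r) * m := by
        rw [hsplit, htotal]
        exact sub_le_sub_left (sum_le_sum hearly) m
    _ = ∑ r ∈ Ioi q, (𝔼 π, firstHireProb sel s x π r) * m := by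
        rw [← sum_mul, ← sum_mul, hsplit, htotal_one, sub_mul, one_mul]
    _ ≤ ∑ r ∈ Ioi q, 𝔼 π, firstHireProb sel s x π r * (x (π r)).1 :=
        sum_le_sum fun r _ => expect_firstHireProb_mul_avg_le hsel hx r

end GrowingProcess

section Signals

variable {n : ℕ}

/-- The signal vector whose only HIRE signal is in round `r`. -/
def hireOnly (r : Fin n) : Fin n → Bool := fun t => decide (t = r)

theorem hireOnly_apply_eq_true {r t : Fin n} : hireOnly r t = true ↔ t = r := decide_eq_true_iff

theorem hireOnly_apply_eq_false {r t : Fin n} : hireOnly r t = false ↔ t ≠ r :=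
  decide_eq_false_iff_not

theorem hireOnly_injective : Function.Injective (hireOnly (n := n)) := fun r _ h =>
  hireOnly_apply_eq_true.1 (congrFun h r ▸ hireOnly_apply_eq_true.2 rfl)

theorem eq_hireOnly {σ : Fin n → Bool} {r : Fin n} (hr : σ r = true)
    (hunique : ∀ t, σ t = true → t = r) : σ = hireOnly r :=
  funext fun t => Bool.eq_iff_iff.2
    ⟨fun ht => hireOnly_apply_eq_true.2 (hunique t ht), fun ht => hireOnly_apply_eq_true.1 ht ▸ hr⟩

theorem univ_image_Iic (x : Fin n → ℝ × ℝ) (π : Order n) (t : Fin n) :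
    (univ.image fun r : Set.Iic t => x (π r.1)) = (arrived π t).image x := by
  ext c
  simp only [arrived, map_eq_image, image_image, mem_image, mem_univ, true_and, mem_Iic,
    Subtype.exists, Set.mem_Iic, exists_prop, Function.comp_apply, Equiv.coe_toEmbedding]

variable (sel : Finset (ℝ × ℝ) → (ℝ × ℝ) × (ℝ × ℝ)) (s : ℕ) (ρ ξ : Fin n → ℝ) (π : Order n)

theorem hireProb_growingPareto_of_forall_lt {σ : Fin n → Bool} {t : Fin n}
    (hσ : ∀ r < t, σ r = false) :
    (growingPareto sel n s).hireProb t (fun r => (ρ (π r.1), ξ (π r.1))) (fun r => σ r.1) =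
      condHireProb sel s (fun i => (ρ i, ξ i)) π t := by
  have hnone : ¬∃ r : Set.Iio t, σ r.1 = true := fun ⟨r, hr⟩ =>
    Bool.false_ne_true ((hσ r.1 r.2).symm.trans hr)
  simp only [growingPareto, if_neg hnone, condHireProb, ruleProb,
    univ_image_Iic fun i => (ρ i, ξ i)]

theorem hireProb_growingPareto_of_lt {σ : Fin n → Bool} {r t : Fin n} (hrt : r < t)
    (hr : σ r = true) :
    (growingPareto sel n s).hireProb t (fun r => (ρ (π r.1), ξ (π r.1))) (fun r => σ r.1) = 0 :=
  if_pos ⟨⟨r, hrt⟩, hr⟩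

theorem signalProb_hireOnly (r : Fin n) :
    signalProb ρ ξ (growingPareto sel n s) π (hireOnly r) =
      firstHireProb sel s (fun i => (ρ i, ξ i)) π r := by
  have hbefore : ∀ t ≤ r, ∀ q < t, hireOnly r q = false := fun t ht q hq =>
    hireOnly_apply_eq_false.2 (hq.trans_le ht).ne
  rw [signalProb, ← prod_subset (subset_univ (Iic r)), ← prod_Iio_mul_eq_prod_Iic, firstHireProb]
  · congr 1
    · refine prod_congr rfl fun t ht => ?_
      have htr := mem_Iio.1 ht
      rw [hireProb_growingPareto_of_forall_lt sel s ρ ξ π (hbefore t htr.le),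
        hireOnly_apply_eq_false.2 htr.ne, if_neg Bool.false_ne_true]
    · rw [hireProb_growingPareto_of_forall_lt sel s ρ ξ π (hbefore r le_rfl),
        if_pos (hireOnly_apply_eq_true.2 rfl)]
  · intro t _ ht
    have hrt : r < t := not_le.1 fun h => ht (mem_Iic.2 h)
    rw [hireProb_growingPareto_of_lt sel s ρ ξ π hrt (hireOnly_apply_eq_true.2 rfl),
      hireOnly_apply_eq_false.2 hrt.ne', if_neg Bool.false_ne_true, sub_zero]

theorem exists_eq_hireOnly_of_signalProb_ne_zero (hn : 1 ≤ n) {σ : Fin n → Bool}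
    (hσ : signalProb ρ ξ (growingPareto sel n s) π σ ≠ 0) : ∃ r, σ = hireOnly r := by
  rw [signalProb, prod_ne_zero_iff] at hσ
  have hle : ∀ {r q}, σ r = true → σ q = true → r ≤ q := fun {r q} hr hq => by
    by_contra! hqr
    refine hσ r (mem_univ r) ?_
    rw [if_pos hr, hireProb_growingPareto_of_lt sel s ρ ξ π hqr hq]
  obtain ⟨r, hr⟩ : ∃ r, σ r = true := by
    by_contra! hnone
    simp only [ne_eq, Bool.not_eq_true] at hnone
    refine hσ ⟨n - 1, Nat.sub_one_lt_of_lt hn⟩ (mem_univ _) ?_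
    rw [hireProb_growingPareto_of_forall_lt sel s ρ ξ π fun r _ => hnone r, hnone,
      if_neg Bool.false_ne_true, condHireProb, if_pos (Nat.sub_add_cancel hn), sub_self]
  exact ⟨r, eq_hireOnly hr fun t ht => le_antisymm (hle ht hr) (hle hr ht)⟩

theorem expectation_eq_expect (M : Mechanism n) (F : Order n → (Fin n → Bool) → ℝ) :
    expectation ρ ξ M F = 𝔼 π, ∑ σ, signalProb ρ ξ M π σ * F π σ := by
  rw [expectation, Fintype.expect_eq_sum_div_card, Fintype.card_perm, Fintype.card_fin]

theorem expectation_growingPareto (hn : 1 ≤ n) (F : Order n → (Fin n → Bool) → ℝ) :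
    expectation ρ ξ (growingPareto sel n s) F =
      ∑ r, 𝔼 π, firstHireProb sel s (fun i => (ρ i, ξ i)) π r * F π (hireOnly r) := by
  rw [expectation_eq_expect, ← expect_sum_comm]
  refine expect_congr rfl fun π _ => (Fintype.sum_of_injective hireOnly hireOnly_injective _ _
    (fun σ hσ => ?_) fun r => ?_).symm
  · have hzero : signalProb ρ ξ (growingPareto sel n s) π σ = 0 := by
      by_contra hne
      obtain ⟨r, rfl⟩ := exists_eq_hireOnly_of_signalProb_ne_zero sel s ρ ξ π hn hne
      exact hσ ⟨r, rfl⟩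
    rw [hzero, zero_mul]
  · rw [signalProb_hireOnly]

theorem expectation_growingPareto_ite (hn : 1 ≤ n) (P : (Fin n → Bool) → Prop) [DecidablePred P]
    (F : Order n → (Fin n → Bool) → ℝ) :
    expectation ρ ξ (growingPareto sel n s) (fun π σ => if P σ then F π σ else 0) =
      ∑ r with P (hireOnly r),
        𝔼 π, firstHireProb sel s (fun i => (ρ i, ξ i)) π r * F π (hireOnly r) := by
  rw [expectation_growingPareto sel s ρ ξ hn, sum_filter]
  refine sum_congr rfl fun r _ => ?_
  split_ifs
  · rfl
  · simp only [mul_zero, expect_const_zero]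

end Signals

section TotalProbability

/-- Given the signals before round `t`, the signal of round `t` is HIRE with probability `f t σ`. -/
theorem sum_prod_signals : ∀ {n : ℕ} {f : Fin n → (Fin n → Bool) → ℝ},
    (∀ t σ τ, (∀ r < t, σ r = τ r) → f t σ = f t τ) →
      ∑ σ : Fin n → Bool, ∏ t, (if σ t = true then f t σ else 1 - f t σ) = 1
  | 0, f, _ => by simp
  | n + 1, f, hf => by
    let rest (σ : Fin n → Bool) : Fin (n + 1) → Bool := Fin.snoc σ false
    have hrest (σ : Fin n → Bool) (b : Bool) (t : Fin (n + 1)) :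
        f t (Fin.snoc σ b) = f t (rest σ) := hf _ _ _ fun r hr => by
      obtain ⟨i, rfl⟩ := Fin.exists_castSucc_eq.2 (hr.trans_le t.le_last).ne
      simp only [rest, Fin.snoc_castSucc]
    have hsnoc (p : Bool × (Fin n → Bool)) :
        Fin.snocEquiv (fun _ => Bool) p = Fin.snoc p.2 p.1 := rfl
    rw [← (Fin.snocEquiv fun _ => Bool).sum_comp, Fintype.sum_prod_type_right]
    simp only [hsnoc, Fin.prod_univ_castSucc, Fin.snoc_castSucc, Fin.snoc_last,
      hrest, ← mul_sum, Fintype.sum_bool, if_true, Bool.false_eq_true, if_false,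
      add_sub_cancel, mul_one]
    refine sum_prod_signals fun t σ τ hστ => hf _ _ _ fun r hr => ?_
    obtain ⟨i, rfl⟩ := Fin.exists_castSucc_eq.2 (hr.trans_le (Fin.le_last _)).ne
    simp only [rest, Fin.snoc_castSucc, hστ i (Fin.castSucc_lt_castSucc_iff.1 hr)]

variable {n : ℕ} (ρ ξ : Fin n → ℝ) (M : Mechanism n) (π : Order n)

theorem sum_signalProb : ∑ σ, signalProb ρ ξ M π σ = 1 :=
  sum_prod_signals (f := fun t σ =>
    M.hireProb t (fun r => (ρ (π r.1), ξ (π r.1))) fun r => σ r.1) fun t _ _ h =>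
      congrArg (M.hireProb t _) (funext fun r : Set.Iio t => h r.1 r.2)

theorem signalProb_nonneg (σ : Fin n → Bool) : 0 ≤ signalProb ρ ξ M π σ := by
  refine prod_nonneg fun t _ => ?_
  split_ifs
  · exact M.hireProb_nonneg _ _ _
  · exact sub_nonneg.2 (M.hireProb_le_one _ _ _)

end TotalProbability

section Receiver

variable {n : ℕ}

theorem hiresAt_unique {d : ReceiverStrategy n} {k : ℕ} {σ : Fin n → Bool} {r r' : Fin n}
    (h : HiresAt d k σ r) (h' : HiresAt d k σ r') : r = r' := by
  rcases lt_trichotomy r r' with hlt | rfl | hlt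
  · exact (Bool.false_ne_true ((h'.2.2 r h.1 hlt).symm.trans h.2.1)).elim
  · rfl
  · exact (Bool.false_ne_true ((h.2.2 r' h'.1 hlt).symm.trans h'.2.1)).elim

theorem hiredValue_of_hiresAt {v : Fin n → ℝ} {d : ReceiverStrategy n} {k : ℕ} {π : Order n}
    {σ : Fin n → Bool} {r : Fin n} (h : HiresAt d k σ r) : hiredValue v d k π σ = v (π r) := by
  rw [hiredValue, Fintype.sum_eq_single r fun q hq => if_neg fun hq' => hq (hiresAt_unique hq' h),
    if_pos h]

theorem hiredValue_of_not {v : Fin n → ℝ} {d : ReceiverStrategy n} {k : ℕ} {π : Order n}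
    {σ : Fin n → Bool} (h : ∀ r, ¬HiresAt d k σ r) : hiredValue v d k π σ = 0 :=
  sum_eq_zero fun r _ => if_neg (h r)

theorem hiresAt_congr {d : ReceiverStrategy n} {k : ℕ} {σ τ : Fin n → Bool} {r : Fin n}
    (h : ∀ q ≤ r, σ q = τ q) : HiresAt d k σ r ↔ HiresAt d k τ r := by
  have hrestrict : ∀ q ≤ r, (fun j : Set.Iic q => σ j.1) = fun j => τ j.1 := fun q hq =>
    funext fun j => h j.1 (j.2.trans hq)
  rw [HiresAt, HiresAt, hrestrict r le_rfl]
  refine and_congr_right' (and_congr_right' (forall_congr' fun q => ?_))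
  exact imp_congr_right fun _ => forall_congr' fun hq => by rw [hrestrict q hq.le]

theorem hiresAt_obedient_hireOnly {k : ℕ} {r : Fin n} (h : k ≤ r) :
    HiresAt (obedient n) k (hireOnly r) r :=
  ⟨h, hireOnly_apply_eq_true.2 rfl, fun _ _ hq => hireOnly_apply_eq_false.2 hq.ne⟩

theorem hiresAt_hireOnly_of_lt {d : ReceiverStrategy n} {k : ℕ} {q r : Fin n} (hqr : q < r) :
    HiresAt d k (hireOnly r) q ↔ HiresAt d k (fun _ => false) q :=
  hiresAt_congr fun _ hj => hireOnly_apply_eq_false.2 (hj.trans_lt hqr).ne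

theorem observed_true_hireOnly {t r : Fin n} : Observed t true (hireOnly r) ↔ r = t :=
  ⟨fun h => (hireOnly_apply_eq_true.1 h.2).symm, fun h => h ▸
    ⟨fun _ hq => hireOnly_apply_eq_false.2 hq.ne, hireOnly_apply_eq_true.2 rfl⟩⟩

theorem observed_false_hireOnly {t r : Fin n} : Observed t false (hireOnly r) ↔ t < r := by
  refine ⟨fun h => not_le.1 fun hrt => ?_, fun h => ⟨fun _ hq =>
    hireOnly_apply_eq_false.2 (hq.trans h).ne, hireOnly_apply_eq_false.2 h.ne⟩⟩
  rcases hrt.lt_or_eq with hlt | rfl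
  · exact hireOnly_apply_eq_false.1 (h.1 r hlt) rfl
  · exact hireOnly_apply_eq_false.1 h.2 rfl

variable {sel : Finset (ℝ × ℝ) → (ℝ × ℝ) × (ℝ × ℝ)} (s : ℕ) {ρ ξ : Fin n → ℝ}

theorem expect_firstHireProb_mul_hiredValue_le (hsel : IsParetoRule sel) (hρ : ∀ i, 0 ≤ ρ i)
    (hx : Function.Injective fun i => (ρ i, ξ i)) {d : ReceiverStrategy n} {k : ℕ} {r : Fin n}
    (hd : ∀ j, HiresAt d k (hireOnly r) j → r ≤ j) :
    𝔼 π, firstHireProb sel s (fun i => (ρ i, ξ i)) π r * hiredValue ρ d k π (hireOnly r) ≤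
      𝔼 π, firstHireProb sel s (fun i => (ρ i, ξ i)) π r * ρ (π r) := by
  by_cases h : ∃ j, HiresAt d k (hireOnly r) j
  · obtain ⟨j, hj⟩ := h
    simp only [hiredValue_of_hiresAt hj]
    rcases (hd j hj).eq_or_lt with rfl | hlt
    · exact le_rfl
    · rw [expect_firstHireProb_mul_of_lt hsel hx hlt ρ]
      exact expect_firstHireProb_mul_avg_le hsel hx r
  · refine expect_le_expect fun π _ => ?_
    rw [hiredValue_of_not (not_exists.1 h)]
    exact mul_le_mul_of_nonneg_left (hρ _) (firstHireProb_nonneg π r)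

theorem sum_Ioi_expect_firstHireProb_mul_hiredValue_le (hsel : IsParetoRule sel)
    (hρ : ∀ i, 0 ≤ ρ i) (hx : Function.Injective fun i => (ρ i, ξ i)) (t : Fin n)
    (d : ReceiverStrategy n) :
    ∑ r ∈ Ioi t, 𝔼 π, firstHireProb sel s (fun i => (ρ i, ξ i)) π r *
        hiredValue ρ d t π (hireOnly r) ≤
      ∑ r ∈ Ioi t, 𝔼 π, firstHireProb sel s (fun i => (ρ i, ξ i)) π r * ρ (π r) := by
  by_cases hq : ∃ q, HiresAt d t (fun _ => false) q
  · obtain ⟨q, hq⟩ := hq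
    have hsplit : Ioi t = Ioc t q ∪ Ioi q := coe_injective (by
      simp only [coe_union, coe_Ioi, coe_Ioc, Set.Ioc_union_Ioi_eq_Ioi (Fin.le_def.2 hq.1)])
    have hdisj : Disjoint (Ioc t q) (Ioi q) :=
      disjoint_left.2 fun r hr hr' => (mem_Ioi.1 hr').not_ge (mem_Ioc.1 hr).2
    rw [hsplit, sum_union hdisj, sum_union hdisj]
    refine add_le_add (sum_le_sum fun r hr => ?_) ?_
    · refine expect_firstHireProb_mul_hiredValue_le s hsel hρ hx fun j hj => not_lt.1 fun hjr => ?_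
      have hjq := hiresAt_unique ((hiresAt_hireOnly_of_lt hjr).1 hj) hq
      exact (mem_Ioc.1 hr).2.not_gt (hjq ▸ hjr)
    · refine le_of_eq_of_le (sum_congr rfl fun r hr => expect_congr rfl fun π _ => ?_)
        (sum_Ioi_expect_firstHireProb_mul_le hsel hx q)
      rw [hiredValue_of_hiresAt ((hiresAt_hireOnly_of_lt (mem_Ioi.1 hr)).2 hq)]
  · exact sum_le_sum fun r _ => expect_firstHireProb_mul_hiredValue_le s hsel hρ hx fun j hj =>
      not_lt.1 fun hjr => hq ⟨j, (hiresAt_hireOnly_of_lt hjr).1 hj⟩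

theorem persuasive_growingPareto (hsel : IsParetoRule sel) (hn : 1 ≤ n) (hρ : ∀ i, 0 ≤ ρ i)
    (hx : Function.Injective fun i => (ρ i, ξ i)) : Persuasive ρ ξ (growingPareto sel n s) := by
  intro t b d
  rw [expectation_growingPareto_ite sel s ρ ξ hn, expectation_growingPareto_ite sel s ρ ξ hn]
  cases b
  · simp only [observed_false_hireOnly, filter_lt_eq_Ioi]
    refine (sum_Ioi_expect_firstHireProb_mul_hiredValue_le s hsel hρ hx t d).trans_eq
      (sum_congr rfl fun r hr => expect_congr rfl fun π _ => ?_)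
    rw [hiredValue_of_hiresAt (hiresAt_obedient_hireOnly (Fin.le_def.1 (mem_Ioi.1 hr).le))]
  · simp only [observed_true_hireOnly, filter_eq', mem_univ, if_true, sum_singleton,
      hiredValue_of_hiresAt (hiresAt_obedient_hireOnly le_rfl)]
    exact expect_firstHireProb_mul_hiredValue_le s hsel hρ hx fun j hj => Fin.le_def.2 hj.1

theorem senderUtility_growingPareto (hn : 1 ≤ n) :
    senderUtility ρ ξ (growingPareto sel n s) =
      ∑ r, 𝔼 π, firstHireProb sel s (fun i => (ρ i, ξ i)) π r * ξ (π r) := by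
  rw [senderUtility, expectation_growingPareto sel s ρ ξ hn]
  simp only [hiredValue_of_hiresAt (hiresAt_obedient_hireOnly (Nat.zero_le _))]

end Receiver

section Benchmark

variable {n : ℕ} {ρ ξ : Fin n → ℝ}

theorem expectation_add (M : Mechanism n) (F G : Order n → (Fin n → Bool) → ℝ) :
    expectation ρ ξ M F + expectation ρ ξ M G = expectation ρ ξ M fun π σ => F π σ + G π σ := by
  simp only [expectation, mul_add, sum_add_distrib, add_div]

theorem expectation_mono (M : Mechanism n) {F G : Order n → (Fin n → Bool) → ℝ}
    (h : ∀ π σ, F π σ ≤ G π σ) : expectation ρ ξ M F ≤ expectation ρ ξ M G := by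
  unfold expectation
  gcongr with π _ σ _
  · exact signalProb_nonneg ρ ξ M π σ
  · exact h π σ

theorem expectation_order (M : Mechanism n) (f : Order n → ℝ) :
    expectation ρ ξ M (fun π _ => f π) = 𝔼 π, f π := by
  simp only [expectation_eq_expect, ← sum_mul, sum_signalProb, one_mul]

/-- The probability that candidate `i` is hired by an obedient receiver. -/
noncomputable def hiredProb (ρ ξ : Fin n → ℝ) (M : Mechanism n) (i : Fin n) : ℝ :=
  expectation ρ ξ M fun π σ => hiredValue (Pi.single i 1) (obedient n) 0 π σ

theorem hiredValue_nonneg {v : Fin n → ℝ} (hv : ∀ i, 0 ≤ v i) (d : ReceiverStrategy n) (k : ℕ)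
    (π : Order n) (σ : Fin n → Bool) : 0 ≤ hiredValue v d k π σ := by
  refine sum_nonneg fun r _ => ?_
  split_ifs
  · exact hv _
  · exact le_rfl

theorem hiredValue_one_le_one (d : ReceiverStrategy n) (k : ℕ) (π : Order n)
    (σ : Fin n → Bool) : hiredValue (fun _ => 1) d k π σ ≤ 1 := by
  by_cases h : ∃ j, HiresAt d k σ j
  · obtain ⟨j, hj⟩ := h
    exact (hiredValue_of_hiresAt hj).le
  · exact (hiredValue_of_not (not_exists.1 h)).trans_le zero_le_one

theorem hiredValue_eq_sum (v : Fin n → ℝ) (d : ReceiverStrategy n) (k : ℕ) (π : Order n)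
    (σ : Fin n → Bool) :
    hiredValue v d k π σ = ∑ i, hiredValue (Pi.single i 1) d k π σ * v i := by
  by_cases h : ∃ j, HiresAt d k σ j
  · obtain ⟨j, hj⟩ := h
    simp only [hiredValue_of_hiresAt hj, Pi.single_apply, ite_mul, one_mul, zero_mul, sum_ite_eq,
      mem_univ, if_true]
  · simp only [hiredValue_of_not (not_exists.1 h), zero_mul, sum_const_zero]

theorem expectation_hiredValue (M : Mechanism n) (v : Fin n → ℝ) :
    expectation ρ ξ M (fun π σ => hiredValue v (obedient n) 0 π σ) =
      ∑ i, hiredProb ρ ξ M i * v i := by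
  simp only [hiredProb, expectation_eq_expect, hiredValue_eq_sum v, mul_sum, expect_mul, sum_mul,
    mul_assoc, ← expect_sum_comm]
  exact expect_congr rfl fun π _ => sum_comm

theorem hiredProb_nonneg (M : Mechanism n) (i : Fin n) : 0 ≤ hiredProb ρ ξ M i := by
  have hsingle : (0 : Fin n → ℝ) ≤ Pi.single i 1 := Pi.single_nonneg.2 zero_le_one
  calc 0 = expectation ρ ξ M fun _ _ => 0 := by
        rw [expectation_order M fun _ => 0, expect_const_zero]
    _ ≤ hiredProb ρ ξ M i := expectation_mono M fun π σ => hiredValue_nonneg hsingle _ 0 π σ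

theorem sum_hiredProb_le_one (M : Mechanism n) : ∑ i, hiredProb ρ ξ M i ≤ 1 :=
  calc ∑ i, hiredProb ρ ξ M i
      = expectation ρ ξ M fun π σ => hiredValue (fun _ => 1) (obedient n) 0 π σ := by
        simp only [expectation_hiredValue, mul_one]
    _ ≤ expectation ρ ξ M fun _ _ => 1 := expectation_mono M (hiredValue_one_le_one _ 0)
    _ = 1 := by rw [expectation_order M fun _ => 1, Fintype.expect_one]

/-- The receiver could hire the first candidate regardless of the signal. -/
theorem Persuasive.expect_le_sum_hiredProb_mul (hn : 1 ≤ n) {M : Mechanism n}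
    (hM : Persuasive ρ ξ M) : 𝔼 i, ρ i ≤ ∑ i, hiredProb ρ ξ M i * ρ i := by
  let first : Fin n := ⟨0, hn⟩
  have hle : ∀ q, ¬q < first := fun q => Nat.not_lt_zero q
  have hobserved (b : Bool) (σ : Fin n → Bool) : Observed first b σ ↔ σ first = b :=
    and_iff_right fun q hq => (hle q hq).elim
  have hhire (π : Order n) (σ : Fin n → Bool) :
      hiredValue ρ (fun _ _ => true) first π σ = ρ (π first) :=
    hiredValue_of_hiresAt ⟨le_rfl, rfl, fun q _ hq => (hle q hq).elim⟩
  have hsum := add_le_add (hM first true fun _ _ => true) (hM first false fun _ _ => true)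
  have hite (σ : Fin n → Bool) (y : ℝ) {_ : Decidable (Observed first true σ)}
      {_ : Decidable (Observed first false σ)} :
      ((if Observed first true σ then y else 0) + if Observed first false σ then y else 0) = y := by
    cases h : σ first <;> simp [hobserved, h]
  simp only [expectation_add, hhire, hite] at hsum
  rwa [expectation_order M fun π => ρ (π first), expect_apply, expectation_hiredValue] at hsum

variable {sel : Finset (ℝ × ℝ) → (ℝ × ℝ) × (ℝ × ℝ)} {x : Fin n → ℝ × ℝ}

theorem IsParetoRule.sum_mul_snd_le (hsel : IsParetoRule sel) (hn : 1 ≤ n)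
    (hx : Function.Injective x) (hx0 : ∀ i, 0 ≤ x i) {p : Fin n → ℝ} (hp : ∀ i, 0 ≤ p i)
    (hp1 : ∑ i, p i ≤ 1) (havg : 𝔼 i, (x i).1 ≤ ∑ i, p i * (x i).1) :
    ∑ i, p i * (x i).2 ≤ (ruleMean sel (univ.image x)).2 := by
  let first : Fin n := ⟨0, hn⟩
  let z : ℝ × ℝ := (1 - ∑ i, p i) • x first
  have hz : 0 ≤ z := smul_nonneg (sub_nonneg.2 hp1) (hx0 first)
  have hmem (i : Fin n) : x i ∈ convexHull ℝ (univ.image x : Set (ℝ × ℝ)) :=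
    subset_convexHull ℝ _ (mem_coe.2 (mem_image_of_mem x (mem_univ i)))
  have hq : z + ∑ i, p i • x i ∈ convexHull ℝ (univ.image x : Set (ℝ × ℝ)) := by
    have hconvex := (convex_convexHull ℝ (univ.image x : Set (ℝ × ℝ))).sum_mem
      (t := univ) (w := fun i : Option (Fin n) => i.elim (1 - ∑ i, p i) p)
      (z := fun i => i.elim (x first) x)
      (fun i _ => i.rec (sub_nonneg.2 hp1) hp)
      (by simp only [Fintype.sum_option, Option.elim, sub_add_cancel])
      (fun i _ => i.rec (hmem first) hmem)
    rw [Fintype.sum_option] at hconvex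
    exact hconvex
  have hfst : (z + ∑ i, p i • x i).1 = z.1 + ∑ i, p i * (x i).1 := by
    simp only [Prod.fst_add, Prod.fst_sum, Prod.smul_fst, smul_eq_mul]
  have hsnd : (z + ∑ i, p i • x i).2 = z.2 + ∑ i, p i * (x i).2 := by
    simp only [Prod.snd_add, Prod.snd_sum, Prod.smul_snd, smul_eq_mul]
  have hle := hsel.snd_le hq (by
    rw [avgReceiver_image hx, hfst]
    exact havg.trans (le_add_of_nonneg_left hz.1))
  rw [hsnd] at hle
  exact (le_add_of_nonneg_left hz.2).trans hle

theorem OPT_le_ruleMean (hsel : IsParetoRule sel) (hn : 1 ≤ n) (hρ : ∀ i, 0 ≤ ρ i)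
    (hξ : ∀ i, 0 ≤ ξ i) (hx : Function.Injective fun i => (ρ i, ξ i)) :
    OPT ρ ξ ≤ (ruleMean sel (univ.image fun i => (ρ i, ξ i))).2 := by
  have hne : (univ.image fun i => (ρ i, ξ i)).Nonempty :=
    ⟨_, mem_image_of_mem _ (mem_univ ⟨0, hn⟩)⟩
  refine Real.sSup_le ?_ (hsel.snd_ruleMean_nonneg hne (forall_mem_image.2 fun i _ => hξ i))
  rintro u ⟨M, hM, rfl⟩
  rw [senderUtility, expectation_hiredValue]
  exact hsel.sum_mul_snd_le hn hx (fun i => ⟨hρ i, hξ i⟩) (hiredProb_nonneg M)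
    (sum_hiredProb_le_one M) (hM.expect_le_sum_hiredProb_mul hn)

end Benchmark

section Sampling

variable {n : ℕ}

/-- The probability that all candidates in `S` arrive in the rounds up to `t`. -/
noncomputable def earlyProb (t : Fin n) (S : Finset (Fin n)) : ℝ :=
  𝔼 π : Order n, if S ⊆ arrived π t then 1 else 0

theorem earlyProb_anti (t : Fin n) : Antitone (earlyProb t) := by
  intro S T hST
  unfold earlyProb
  gcongr with π
  split_ifs with hT hS
  exacts [le_rfl, (hS (hST.trans hT)).elim, zero_le_one, le_rfl]

theorem earlyProb_map (t : Fin n) (S : Finset (Fin n)) (τ : Order n) :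
    earlyProb t (S.map τ.toEmbedding) = earlyProb t S :=
  (Fintype.expect_equiv (Equiv.mulLeft τ) _ _ fun π => by
    have harrived : arrived (τ * π) t = (arrived π t).map τ.toEmbedding := by
      rw [arrived, arrived, Finset.map_map]
      rfl
    simp only [Equiv.coe_mulLeft, harrived, map_subset_map]).symm

theorem earlyProb_congr (t : Fin n) {S T : Finset (Fin n)} (h : #S = #T) :
    earlyProb t S = earlyProb t T := by
  let e : S ≃ T := equivOfCardEq h
  have hmap : S.map e.extendSubtype.toEmbedding = T := by
    refine eq_of_subset_of_card_le (fun i hi => ?_) (by rw [card_map, h])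
    obtain ⟨j, hj, rfl⟩ := mem_map.1 hi
    exact e.extendSubtype_mem j hj
  rw [← hmap, earlyProb_map]

theorem choose_mul_earlyProb (t : Fin n) (S : Finset (Fin n)) :
    n.choose #S * earlyProb t S = ((t : ℕ) + 1).choose #S := by
  have hcount (π : Order n) :
      #{T ∈ powersetCard #S univ | T ⊆ arrived π t} = ((t : ℕ) + 1).choose #S := by
    rw [← card_arrived π t, ← card_powersetCard]
    congr 1
    ext T
    simp only [mem_filter, mem_powersetCard, subset_univ, true_and, and_comm]
  calc n.choose #S * earlyProb t S
      = ∑ T ∈ powersetCard #S univ, earlyProb t T := by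
        rw [sum_congr rfl fun T hT => earlyProb_congr t (mem_powersetCard.1 hT).2, sum_const,
          card_powersetCard, card_univ, Fintype.card_fin, nsmul_eq_mul]
    _ = ((t : ℕ) + 1).choose #S := by
        simp only [earlyProb, ← expect_sum_comm, sum_boole, hcount, Fintype.expect_const]

theorem choose_three_le_mul_earlyProb (t i j l : Fin n) :
    (((t : ℕ) + 1).choose 3 : ℝ) ≤ n.choose 3 * earlyProb t {i, j, l} := by
  obtain hn | hn := lt_or_ge n 3
  · rw [Nat.choose_eq_zero_of_lt hn, Nat.choose_eq_zero_of_lt (lt_of_le_of_lt t.2 hn),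
      Nat.cast_zero, zero_mul]
  obtain ⟨S, hS, hS3⟩ := exists_superset_card_eq (s := {i, j, l}) card_le_three
    (hn.trans_eq (Fintype.card_fin n).symm)
  rw [← hS3, ← choose_mul_earlyProb t S, hS3]
  gcongr
  exact earlyProb_anti t hS

end Sampling

section SampleValue

theorem exists_mem_stdSimplex_mul_sum_eq {ι : Type*} [Fintype ι] [Nonempty ι] {f : ι → ℝ}
    (hf : ∀ i, 0 ≤ f i) : ∃ c ∈ stdSimplex ℝ ι, ∀ i, c i * ∑ j, f j = f i := by
  classical
  by_cases hsum : ∑ j, f j = 0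
  · have hzero := (Fintype.sum_eq_zero_iff_of_nonneg hf).1 hsum
    exact ⟨Pi.single (Classical.arbitrary ι) 1, single_mem_stdSimplex ℝ _, fun i => by
      rw [hsum, mul_zero, hzero, Pi.zero_apply]⟩
  · exact ⟨fun i => f i / ∑ j, f j,
      ⟨fun i => div_nonneg (hf i) (sum_nonneg fun j _ => hf j), by rw [← sum_div, div_self hsum]⟩,
      fun i => div_mul_cancel₀ _ hsum⟩

theorem sum_posPart_sub_expect {ι : Type*} [Fintype ι] (f : ι → ℝ) :
    ∑ i, (f i - 𝔼 j, f j)⁺ = ∑ i, (f i - 𝔼 j, f j)⁻ := by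
  rw [← sub_eq_zero, ← sum_sub_distrib]
  simp only [posPart_sub_negPart, sum_sub_distrib, sum_const, card_univ, Fintype.card_smul_expect,
    sub_self]

/-- The total surplus above the mean equals the total shortfall below it, so the shortfall in `I`
compensates at least the share `w` of the surplus in `I`. -/
theorem expect_le_of_mul_sum_negPart_le {ι : Type*} [Fintype ι] {f : ι → ℝ} {I : Finset ι}
    (hI : I.Nonempty) {w M : ℝ} (hw : w ∈ Set.Icc 0 1) (hM : ∀ i ∈ I, f i ≤ M)
    (hshort : w * ∑ i, (f i - 𝔼 j, f j)⁻ ≤ ∑ i ∈ I, (f i - 𝔼 j, f j)⁻) :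
    𝔼 i ∈ I, f i ≤ w * 𝔼 j, f j + (1 - w) * M := by
  set m := 𝔼 j, f j
  obtain hMm | hmM := le_total M m
  · have hle : 𝔼 i ∈ I, f i ≤ M := expect_le hI hM
    linarith [mul_le_mul_of_nonneg_left hMm hw.1]
  have hsurplus : w * 𝔼 i ∈ I, (f i - m)⁺ ≤ 𝔼 i ∈ I, (f i - m)⁻ := by
    rw [expect_eq_sum_div_card, expect_eq_sum_div_card, ← mul_div_assoc]
    gcongr
    refine le_trans ?_ hshort
    rw [← sum_posPart_sub_expect]
    exact mul_le_mul_of_nonneg_left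
      (sum_le_sum_of_subset_of_nonneg (subset_univ I) fun i _ _ => posPart_nonneg _) hw.1
  have hbound : 𝔼 i ∈ I, (f i - m)⁺ ≤ M - m := expect_le hI fun i hi =>
    sup_le (sub_le_sub_right (hM i hi) m) (sub_nonneg.2 hmM)
  have hdecomp : 𝔼 i ∈ I, f i - m = 𝔼 i ∈ I, (f i - m)⁺ - 𝔼 i ∈ I, (f i - m)⁻ := by
    rw [← expect_sub_distrib]
    simp only [posPart_sub_negPart, expect_sub_distrib, expect_const hI]
  linarith [mul_le_mul_of_nonneg_left hbound (sub_nonneg.2 hw.2)]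

variable {n : ℕ} {sel : Finset (ℝ × ℝ) → (ℝ × ℝ) × (ℝ × ℝ)} {x : Fin n → ℝ × ℝ}

theorem ruleMean_mem_convexHull {A B : Finset (ℝ × ℝ)} (hfst : (sel A).1 ∈ B)
    (hsnd : (sel A).2 ∈ B) : ruleMean sel A ∈ convexHull ℝ (B : Set (ℝ × ℝ)) :=
  segment_subset_convexHull hfst hsnd ⟨uniformCdf _, 1 - uniformCdf _, le_max_left _ _,
    sub_nonneg.2 (max_le zero_le_one (min_le_left _ _)), add_sub_cancel _ _, rfl⟩

theorem IsParetoRule.mul_snd_ruleMean_le (hsel : IsParetoRule sel) (hx : Function.Injective x)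
    (hx0 : ∀ i, 0 ≤ (x i).2) {I : Finset (Fin n)} {w : ℝ} (hw : w ∈ Set.Icc 0 1)
    (hshort : w * ∑ i, ((x i).1 - 𝔼 j, (x j).1)⁻ ≤ ∑ i ∈ I, ((x i).1 - 𝔼 j, (x j).1)⁻)
    (hmem : ruleMean sel (univ.image x) ∈ convexHull ℝ (I.image x : Set (ℝ × ℝ))) :
    w * (ruleMean sel (univ.image x)).2 ≤ (ruleMean sel (I.image x)).2 := by
  have hI : I.Nonempty :=
    image_nonempty.1 (coe_nonempty.1 (convexHull_nonempty_iff.1 ⟨_, hmem⟩))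
  obtain ⟨e, he, hmax⟩ := I.exists_max_image (fun i => (x i).1) hI
  have hq : w • ruleMean sel (univ.image x) + (1 - w) • x e ∈
      convexHull ℝ (I.image x : Set (ℝ × ℝ)) :=
    convex_convexHull ℝ _ hmem (subset_convexHull ℝ _ (mem_coe.2 (mem_image_of_mem x he)))
      hw.1 (sub_nonneg.2 hw.2) (add_sub_cancel _ _)
  have hmean : 𝔼 i, (x i).1 ≤ (ruleMean sel (univ.image x)).1 :=
    (avgReceiver_image hx univ).ge.trans
      (hsel.avgReceiver_le ((hI.mono (subset_univ I)).image x))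
  have havg : avgReceiver (I.image x) ≤
      (w • ruleMean sel (univ.image x) + (1 - w) • x e).1 := by
    rw [avgReceiver_image hx]
    refine (expect_le_of_mul_sum_negPart_le hI hw hmax hshort).trans ?_
    exact add_le_add_left (mul_le_mul_of_nonneg_left hmean hw.1) _
  exact (le_add_of_nonneg_right (mul_nonneg (sub_nonneg.2 hw.2) (hx0 e))).trans
    (hsel.snd_le hq havg)

/-- The indices `i` and `j` are those of the pair selected on the whole set, and the weights are
proportional to the shortfall of the receiver values below their mean. -/
theorem IsParetoRule.exists_sum_mul_snd_ruleMean_le (hsel : IsParetoRule sel) (hn : 1 ≤ n)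
    (hx : Function.Injective x) (hx0 : ∀ i, 0 ≤ (x i).2) :
    ∃ c ∈ stdSimplex ℝ (Fin n), ∃ i j, ∀ I : Finset (Fin n), I.Nonempty →
      ∑ l, c l * (if {i, j, l} ⊆ I then 1 else 0) * (ruleMean sel (univ.image x)).2 ≤
        (ruleMean sel (I.image x)).2 := by
  have : Nonempty (Fin n) := ⟨⟨0, hn⟩⟩
  obtain ⟨c, hc, hshort⟩ := exists_mem_stdSimplex_mul_sum_eq
    (f := fun i => ((x i).1 - 𝔼 j, (x j).1)⁻) fun i => negPart_nonneg _
  obtain ⟨ha, hb, -⟩ := hsel.isParetoPair (univ_nonempty.image x)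
  obtain ⟨i, -, hi⟩ := mem_image.1 ha
  obtain ⟨j, -, hj⟩ := mem_image.1 hb
  refine ⟨c, hc, i, j, fun I hI => ?_⟩
  by_cases hij : i ∈ I ∧ j ∈ I
  · simp only [insert_subset_iff, singleton_subset_iff, hij, true_and, mul_boole, ← sum_mul,
      sum_ite_mem, univ_inter]
    refine hsel.mul_snd_ruleMean_le hx hx0 ⟨sum_nonneg fun l _ => hc.1 l, hc.2 ▸
      sum_le_sum_of_subset_of_nonneg (subset_univ I) fun l _ _ => hc.1 l⟩ ?_ ?_
    · rw [sum_mul, sum_congr rfl fun l _ => hshort l]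
    · exact ruleMean_mem_convexHull (hi ▸ mem_image_of_mem x hij.1)
        (hj ▸ mem_image_of_mem x hij.2)
  · simp only [insert_subset_iff, singleton_subset_iff, ← and_assoc, hij, false_and, if_false,
      mul_zero, zero_mul, sum_const_zero]
    exact hsel.snd_ruleMean_nonneg (hI.image x) (forall_mem_image.2 fun i _ => hx0 i)

theorem IsParetoRule.choose_mul_snd_ruleMean_le (hsel : IsParetoRule sel)
    (hx : Function.Injective x) (hx0 : ∀ i, 0 ≤ (x i).2) (t : Fin n) :
    ((t : ℕ) + 1).choose 3 * (ruleMean sel (univ.image x)).2 ≤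
      n.choose 3 * 𝔼 π, (ruleMean sel ((arrived π t).image x)).2 := by
  obtain ⟨c, hc, i, j, hsample⟩ := hsel.exists_sum_mul_snd_ruleMean_le t.pos hx hx0
  have hV : 0 ≤ (ruleMean sel (univ.image x)).2 := hsel.snd_ruleMean_nonneg
    (image_nonempty.2 ⟨t, mem_univ t⟩) (forall_mem_image.2 fun i _ => hx0 i)
  set V := (ruleMean sel (univ.image x)).2
  calc ((t : ℕ) + 1).choose 3 * V
      = ∑ l, c l * (((t : ℕ) + 1).choose 3 * V) := by rw [← sum_mul, hc.2, one_mul]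
    _ ≤ ∑ l, c l * (n.choose 3 * earlyProb t {i, j, l} * V) := by
        gcongr with l
        · exact hc.1 l
        · exact choose_three_le_mul_earlyProb t i j l
    _ = n.choose 3 * 𝔼 π, ∑ l, c l * (if {i, j, l} ⊆ arrived π t then 1 else 0) * V := by
        simp only [earlyProb, expect_sum_comm, ← expect_mul, ← mul_expect, mul_sum]
        exact sum_congr rfl fun l _ => by ring
    _ ≤ n.choose 3 * 𝔼 π, (ruleMean sel ((arrived π t).image x)).2 := by
        gcongr with π
        exact hsample _ (arrived_nonempty π t)

end SampleValue

section Ratio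

variable {n s : ℕ} {sel : Finset (ℝ × ℝ) → (ℝ × ℝ) × (ℝ × ℝ)}

/-- The competitive ratio of the Growing Pareto mechanism with sample size `s`. The factors are
lower bounds for the probability of reaching round `r`, for the probability of a HIRE signal in
that round, and for the value of the Pareto procedure on the candidates seen so far relative to its
value on all candidates. -/
noncomputable def ratio (n s : ℕ) : ℝ :=
  ∑ r ∈ Ico s (n - 1), (s / r : ℝ) * (1 / (r + 1) * ((r + 1).choose 3 / n.choose 3))

theorem ratio_nonneg (n s : ℕ) : 0 ≤ ratio n s :=
  sum_nonneg fun _ _ => by positivity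

theorem le_expect_firstHireProb_mul_snd {x : Fin n → ℝ × ℝ} (hsel : IsParetoRule sel)
    (hx : Function.Injective x) (hx0 : ∀ i, 0 ≤ (x i).2) {r : Fin n} (hs : s ≤ r)
    (hr : (r : ℕ) + 1 < n) :
    (s / r : ℝ) * (1 / (r + 1) * (((r : ℕ) + 1).choose 3 / n.choose 3)) *
        (ruleMean sel (univ.image x)).2 ≤
      𝔼 π, firstHireProb sel s x π r * (x (π r)).2 := by
  have hcurrent : 𝔼 π, condHireProb sel s x π r * (x (π r)).2 =
      1 / (r + 1) * 𝔼 π, (ruleMean sel ((arrived π r).image x)).2 :=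
    expect_condHireProb_mul_current hsel hx hs hr (LinearMap.snd ℝ ℝ ℝ)
  have hnonneg {I : Finset (Fin n)} (hI : I.Nonempty) : 0 ≤ (ruleMean sel (I.image x)).2 :=
    hsel.snd_ruleMean_nonneg (hI.image x) (forall_mem_image.2 fun i _ => hx0 i)
  have hV := hnonneg ⟨r, mem_univ r⟩
  have hsample : ((r : ℕ) + 1).choose 3 / n.choose 3 * (ruleMean sel (univ.image x)).2 ≤
      𝔼 π, (ruleMean sel ((arrived π r).image x)).2 := by
    rw [div_mul_eq_mul_div]
    refine div_le_of_le_mul₀ (Nat.cast_nonneg _)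
      (expect_nonneg fun π _ => hnonneg (arrived_nonempty π r)) ?_
    rw [mul_comm (expect _ _)]
    exact hsel.choose_mul_snd_ruleMean_le hx hx0 r
  rw [expect_firstHireProb_mul hsel hx (invariantBefore_apply (fun i => (x i).2) le_rfl), hcurrent,
    mul_assoc, mul_assoc]
  exact mul_le_mul (div_le_prod_one_sub_hireRate hs)
    (mul_le_mul_of_nonneg_left hsample (by positivity)) (by positivity)
    (prod_nonneg fun q _ => sub_nonneg.2 (hireRate_le_one n s q))

theorem ratio_mul_OPT_le_senderUtility {ρ ξ : Fin n → ℝ} (s : ℕ) (hsel : IsParetoRule sel)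
    (hn : 1 ≤ n) (hρ : ∀ i, 0 ≤ ρ i) (hξ : ∀ i, 0 ≤ ξ i)
    (hx : Function.Injective fun i => (ρ i, ξ i)) :
    ratio n s * OPT ρ ξ ≤ senderUtility ρ ξ (growingPareto sel n s) := by
  refine (mul_le_mul_of_nonneg_left (OPT_le_ruleMean hsel hn hρ hξ hx) (ratio_nonneg n s)).trans ?_
  rw [senderUtility_growingPareto s hn, ratio, sum_mul]
  set V := (ruleMean sel (univ.image fun i => (ρ i, ξ i))).2
  let bound (r : ℕ) : ℝ := (s / r : ℝ) * (1 / (r + 1) * ((r + 1).choose 3 / n.choose 3)) * V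
  have hrange : Ico s (n - 1) ⊆ range n := fun r hr =>
    mem_range.2 ((mem_Ico.1 hr).2.trans_le (Nat.sub_le n 1))
  calc ∑ r ∈ Ico s (n - 1), bound r
      = ∑ r : Fin n, if (r : ℕ) ∈ Ico s (n - 1) then bound r else 0 := by
        rw [Fin.sum_univ_eq_sum_range fun r => if r ∈ Ico s (n - 1) then bound r else 0,
          sum_ite_mem, inter_eq_right.2 hrange]
    _ ≤ ∑ r, 𝔼 π, firstHireProb sel s (fun i => (ρ i, ξ i)) π r * ξ (π r) := by
        refine sum_le_sum fun r _ => ?_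
        split_ifs with hr
        · exact le_expect_firstHireProb_mul_snd hsel hx hξ (mem_Ico.1 hr).1
            (Nat.add_lt_of_lt_sub (mem_Ico.1 hr).2)
        · exact expect_nonneg fun π _ => mul_nonneg (firstHireProb_nonneg π r) (hξ _)

theorem cast_choose_three (m : ℕ) :
    (m.choose 3 : ℝ) = (m : ℝ) * (m - 1) * (m - 2) / 6 := by
  induction m with
  | zero => simp
  | succ m ih =>
    rw [Nat.choose_succ_succ, Nat.cast_add, ih, Nat.cast_choose_two]
    push_cast
    ring

theorem sum_Ico_sub_one {m : ℕ} (h : s ≤ m) :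
    ∑ r ∈ Ico s m, ((r : ℝ) - 1) =
      (((m : ℝ) - 1) * (m - 2) - ((s : ℝ) - 1) * (s - 2)) / 2 := by
  induction m, h using Nat.le_induction with
  | base => simp
  | succ m hm ih =>
    rw [sum_Ico_succ_top hm, ih]
    push_cast
    ring

theorem ratio_eq (hs : 1 ≤ s) (hsn : s < n) :
    ratio n s = s * (((n : ℝ) - 2) * (n - 3) - ((s : ℝ) - 1) * (s - 2)) /
      (2 * (n * (n - 1) * (n - 2))) := by
  have hterm : ∀ r ∈ Ico s (n - 1),
      (s / r : ℝ) * (1 / (r + 1) * ((r + 1).choose 3 / n.choose 3)) =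
        s / (n * (n - 1) * (n - 2)) * (r - 1) := fun r hr => by
    have hr0 : (r : ℝ) ≠ 0 :=
      Nat.cast_ne_zero.2 (Nat.one_le_iff_ne_zero.1 (hs.trans (mem_Ico.1 hr).1))
    rw [cast_choose_three, cast_choose_three, Nat.cast_add_one]
    field_simp
    ring
  rw [ratio, sum_congr rfl hterm, ← mul_sum, sum_Ico_sub_one (Nat.le_sub_one_of_lt hsn),
    Nat.cast_sub (hs.trans hsn.le), Nat.cast_one, div_mul_div_comm]
  congr 1 <;> ring

theorem tendsto_floor_div_sqrt_three_div :
    Tendsto (fun n : ℕ => (⌊(n : ℝ) / √3⌋₊ : ℝ) / n) atTop (𝓝 (1 / √3)) := by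
  have hfloor := (tendsto_nat_floor_mul_div_atTop (R := ℝ) (a := 1 / √3) (by positivity)).comp
    tendsto_natCast_atTop_atTop
  refine hfloor.congr fun n => ?_
  rw [Function.comp_apply, one_div_mul_eq_div]

theorem tendsto_ratio :
    Tendsto (fun n : ℕ => ratio n ⌊(n : ℝ) / √3⌋₊) atTop (𝓝 (1 / (3 * √3))) := by
  let u (n : ℕ) : ℝ := 1 / n
  let y (n : ℕ) : ℝ := ⌊(n : ℝ) / √3⌋₊ / n
  have hu : Tendsto u atTop (𝓝 0) := tendsto_one_div_atTop_nhds_zero_nat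
  have hy : Tendsto y atTop (𝓝 (1 / √3)) := tendsto_floor_div_sqrt_three_div
  have hone_sub (c : ℝ) : Tendsto (fun n => 1 - c * u n) atTop (𝓝 (1 - c * 0)) :=
    tendsto_const_nhds.sub (hu.const_mul c)
  have hlim := (hy.mul (((hone_sub 2).mul (hone_sub 3)).sub
    ((hy.sub hu).mul (hy.sub (hu.const_mul 2))))).div
      (((hone_sub 1).mul (hone_sub 2)).const_mul 2) (by norm_num)
  have hval : 1 / √3 * ((1 - 2 * 0) * (1 - 3 * 0) - (1 / √3 - 0) * (1 / √3 - 2 * 0)) /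
      (2 * ((1 - 1 * 0) * (1 - 2 * 0))) = 1 / (3 * √3) := by
    have hsq : √3 ^ 2 = 3 := Real.sq_sqrt zero_le_three
    field_simp
    rw [hsq]
    norm_num
  rw [hval] at hlim
  refine hlim.congr' ?_
  filter_upwards [eventually_ge_atTop 2] with n hn
  have hn2 : (2 : ℝ) ≤ n := Nat.ofNat_le_cast.2 hn
  have hsqrt_one : 1 < √3 := Real.lt_sqrt_of_sq_lt (by norm_num)
  have hsqrt_two : √3 ≤ 2 := Real.sqrt_le_iff.2 (by norm_num)
  have hs : 1 ≤ ⌊(n : ℝ) / √3⌋₊ :=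
    Nat.one_le_floor_iff _ |>.2 ((one_le_div (by positivity)).2 (hsqrt_two.trans hn2))
  have hsn : ⌊(n : ℝ) / √3⌋₊ < n :=
    (Nat.floor_lt (by positivity)).2 (div_lt_self (by positivity) hsqrt_one)
  simp only [ratio_eq hs hsn, Pi.div_apply, u, y]
  field_simp

end Ratio

end SecretaryPersuasion

theorem mainTheorem2 :
    ∃ ε : ℕ → ℝ, Tendsto ε atTop (𝓝 0) ∧
      ∀ (sel : Finset (ℝ × ℝ) → (ℝ × ℝ) × (ℝ × ℝ)), SecretaryPersuasion.IsParetoRule sel →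
      ∀ (n : ℕ), 1 ≤ n → ∀ (ρ ξ : Fin n → ℝ),
        (∀ i, 0 ≤ ρ i) → (∀ i, 0 ≤ ξ i) → Function.Injective (fun i => (ρ i, ξ i)) →
          SecretaryPersuasion.Persuasive ρ ξ
            (SecretaryPersuasion.growingPareto sel n ⌊(n : ℝ) / √3⌋₊) ∧
          (1 / (3 * √3) - ε n) * SecretaryPersuasion.OPT ρ ξ ≤
            SecretaryPersuasion.senderUtility ρ ξ
              (SecretaryPersuasion.growingPareto sel n ⌊(n : ℝ) / √3⌋₊) := by
  refine ⟨fun n => 1 / (3 * √3) - SecretaryPersuasion.ratio n ⌊(n : ℝ) / √3⌋₊, ?_,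
    fun sel hsel n hn ρ ξ hρ hξ hx =>
      ⟨SecretaryPersuasion.persuasive_growingPareto _ hsel hn hρ hx, ?_⟩⟩
  · rw [← sub_self (1 / (3 * √3))]
    exact tendsto_const_nhds.sub SecretaryPersuasion.tendsto_ratio
  · rw [sub_sub_cancel]
    exact SecretaryPersuasion.ratio_mul_OPT_le_senderUtility _ hsel hn hρ hξ hx
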